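/- Let $K$ be an algebraic number field of degree $n$, let $p$ be a prime number and let $\mathcal{O}$ be an order in $K$ (a subring of $K$ that is finitely generated over $\mathbb{Z}$ and contains a $\mathbb{Q}$-basis of $K$). For $\mathbb{Z}$-submodules $X, Y$ of $K$ let $XY$ be the $\mathbb{Z}$-module generated by all products $xy$ with $x\in X$, $y\in Y$. A subscript $p$ denotes completion: for a lattice $M\subseteq K$ put $M_p = M\otimes_{\mathbb{Z}}\mathbb{Z}_p \subseteq K_p := \mathbb{Q}_p\otimes_{\mathbb{Q}} K$. A maximal suborder of $\mathcal{O}_p$ is a maximal element of the set of all $\mathbb{Z}_p$-orders in $K_p$ that are properly contained in $\mathcal{O}_p$. Let $J_p(\mathcal{O})$ be the intersection of the prime ideals of $\mathcal{O}$ over $p$. We say that a lattice $I$ in $K$ satisfies $(*)$ if $$p\in I,\qquad I^2\subseteq I\subseteq J_p(\mathcal{O}),\qquad I^r \text{ is an invertible ideal of } \mathcal{O} \text{ for some } 1\le r<n .$$ (1) Let $H$ be a sublattice of $\mathcal{O}$ such that $[\mathcal{O}:H]$ is a power of $p$ and $\mathcal{O}H=\mathcal{O}$. Then $H^r\neq\mathcal{O}$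 for all $r\ge 1$ if and only if $uH_p\subseteq\Lambda_p$ for some unit $u\in\mathcal{O}_p^*$ and some maximal suborder $\Lambda_p$ of $\mathcal{O}_p$. (2) Let $I$ be a sublattice of $\mathcal{O}$ with $p\in I$ such that $[\mathcal{O}:I]$ is a power of $p$ and $\mathfrak{a}:=I\mathcal{O}\subseteq J_p(\mathcal{O})$ is an invertible ideal of $\mathcal{O}$. Let $\mathfrak{b}\subseteq J_p(\mathcal{O})^2+p\mathcal{O}$ be an ideal of $\mathcal{O}$ such that $\mathfrak{a}^2\mathfrak{b}\subseteq I$, and let $\tilde I:=I+\mathfrak{a}\mathfrak{b}$. Then $I$ satisfies $(*)$ if and only if $\tilde I$ satisfies $(*)$ and $\tilde I^2\subseteq I$. -/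

import Mathlib

open scoped TensorProduct

/-- `M` is a full `R`-lattice in the `F`-algebra `A` (`F` the fraction field of `R`): a finitely
generated `R`-submodule that contains an `F`-basis of `A`, i.e. that spans `A` over `F`. -/
structure IsFullLattice (R F : Type*) {A : Type*} [CommRing R] [Field F] [CommRing A]
    [Algebra R A] [Algebra F A] (M : Submodule R A) : Prop where
  fg : M.FG
  span_eq_top : Submodule.span F (M : Set A) = ⊤

/-- An `R`-order in `A`: a subring (containing `R`) that is a full `R`-lattice. -/
def IsOrder (R F : Type*) {A : Type*} [CommRing R] [Field F] [CommRing A]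
    [Algebra R A] [Algebra F A] (O : Subalgebra R A) : Prop :=
  IsFullLattice R F (Subalgebra.toSubmodule O)

/-- `L` is a maximal suborder of `O`: it is maximal among the orders properly contained in `O`. -/
def IsMaximalSuborder (R F : Type*) {A : Type*} [CommRing R] [Field F] [CommRing A]
    [Algebra R A] [Algebra F A] (L O : Subalgebra R A) : Prop :=
  Maximal (fun S : Subalgebra R A => IsOrder R F S ∧ S < O) L

section Global

variable {K : Type*} [Field K]

/-- The `ℤ`-submodule of `K` underlying an ideal of `O ⊆ K`. -/
def idealLattice {O : Subalgebra ℤ K} (b : Ideal O) : Submodule ℤ K :=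
  (b.restrictScalars ℤ).map O.val.toLinearMap

/-- The `p`-radical of `O`: the intersection of the prime ideals of `O` over `p`. -/
noncomputable def pRadical (p : ℕ) (O : Subalgebra ℤ K) : Ideal O :=
  sInf (Ideal.primesOver (Ideal.span {(p : ℤ)}) O)

/-- `I` is contained in `O` and the index `[O : I]` is (finite and) a power of `p`. -/
def HasPPowerIndex (p : ℕ) (O : Subalgebra ℤ K) (I : Submodule ℤ K) : Prop :=
  I ≤ Subalgebra.toSubmodule O ∧
    ∃ k : ℕ, I.toAddSubgroup.relIndex (Subalgebra.toSubmodule O).toAddSubgroup = p ^ k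

variable [CharZero K]

/-- A fractional ideal of `O`: a full `ℤ`-lattice `I` in `K` with `I O ⊆ I`. -/
def IsFracIdeal (O : Subalgebra ℤ K) (I : Submodule ℤ K) : Prop :=
  IsFullLattice ℤ ℚ I ∧ I * Subalgebra.toSubmodule O ≤ I

/-- `I` is a fractional ideal of `O` that is invertible: `I X = O` for a fractional ideal `X`. -/
def IsInvertibleIdeal (O : Subalgebra ℤ K) (I : Submodule ℤ K) : Prop :=
  IsFracIdeal O I ∧
    ∃ X : Submodule ℤ K, IsFracIdeal O X ∧ I * X = Subalgebra.toSubmodule O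

/-- The condition on lattices `I` in `K`: `p ∈ I`, `I² ⊆ I ⊆ J_p(O)`, and `I ^ r` is an
invertible ideal of `O` for some `1 ≤ r < n = [K : ℚ]`
(equivalently, there is a minimal such `r`). -/
structure SatisfiesCond (p : ℕ) (O : Subalgebra ℤ K) (I : Submodule ℤ K) : Prop where
  p_mem : (p : K) ∈ I
  sq_le : I ^ 2 ≤ I
  le_pRadical : I ≤ idealLattice (pRadical p O)
  exists_pow : ∃ r : ℕ, 1 ≤ r ∧ r < Module.finrank ℚ K ∧ IsInvertibleIdeal O (I ^ r)

end Global

section Local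

variable {K : Type*} [Field K] [CharZero K] (p : ℕ) [Fact p.Prime]

/-- The completion `M_p = M ⊗ ℤ_p` of a lattice `M` in `K`, realised inside `K_p = ℚ_p ⊗ K` as
the `ℤ_p`-span of the image of `M`. -/
noncomputable def completion (M : Submodule ℤ K) : Submodule ℤ_[p] (ℚ_[p] ⊗[ℚ] K) :=
  Submodule.span ℤ_[p] ((fun x : K => (1 : ℚ_[p]) ⊗ₜ[ℚ] x) '' (M : Set K))

theorem one_mem_completion (O : Subalgebra ℤ K) :
    (1 : ℚ_[p] ⊗[ℚ] K) ∈ completion p (Subalgebra.toSubmodule O) :=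
  Submodule.subset_span ⟨1, O.one_mem, rfl⟩

theorem mul_mem_completion (O : Subalgebra ℤ K) (x y : ℚ_[p] ⊗[ℚ] K)
    (hx : x ∈ completion p (Subalgebra.toSubmodule O))
    (hy : y ∈ completion p (Subalgebra.toSubmodule O)) :
    x * y ∈ completion p (Subalgebra.toSubmodule O) := by
  have h := Submodule.mul_mem_mul hx hy
  unfold completion at h ⊢
  rw [Submodule.span_mul_span] at h
  refine Submodule.span_mono ?_ h
  rintro _ ⟨_, ⟨a, ha, rfl⟩, _, ⟨b, hb, rfl⟩, rfl⟩
  exact ⟨a * b, O.mul_mem ha hb, by simp⟩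

/-- The completion `O_p` of an order `O`, as a `ℤ_p`-subalgebra of `K_p = ℚ_p ⊗ K`. -/
noncomputable def completedOrder (O : Subalgebra ℤ K) : Subalgebra ℤ_[p] (ℚ_[p] ⊗[ℚ] K) :=
  (completion p (Subalgebra.toSubmodule O)).toSubalgebra (one_mem_completion p O)
    (mul_mem_completion p O)

end Local

/-!
Everything is reduced to statements modulo `p`.

**Powers that become the whole order.** In a finite commutative ring `A` the powers of a subgroup
`V` with `A V = A` eventually hit an idempotent `E = V ^ m`, and the determinant trick for the
ideal `E` of `ℤ + E` acting on `A` gives `1 ∈ E`, so that `E` is a subring (`exists_one_mem_pow`).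
For `A = O / pO` and the image of `H` this says that `S = H ^ m + pO` is an order.
If no power of `H` is `O`, then `S ≠ O` by Nakayama's lemma (the index of `H` being a power of `p`
makes it elementary), so `S_p` is a proper suborder of `O_p` and lies in a maximal one.
After inverting `1 + pS`, whose elements are units of `S_p`, the `S`-module `HS` is invertible with
inverse `H ^ (m - 1) S`; since only finitely many maximal ideals of `S` contain `p`, it is
principal there, and a generator `w` of the inverse gives the unit `u` with `u H_p ⊆ S_p`.
Conversely `u H_p ⊆ L` and `H ^ r = O` would give `u ^ r O_p ⊆ L`.

**The condition on `I` and `I'`.** The direction from `I` to `I'` is formal, as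
`(I + ab) ^ r ⊆ I ^ r + a ^ r b`. Conversely, an element `ξ` of the inverse of `a` that inverts a
generator modulo `p` moves `I` to a subgroup `W = ξ I` of `O`, for which `W O = O` modulo `p` and
`W ^ r + J ^ 2 = O` modulo `p`, with `J` the `p`-radical. It remains to see that
`W ^ (n - 1) = O` modulo `p` (`pow_eq_top_of_sup_sq`). Over an infinite field such a subspace
contains a unit and may be assumed to contain `1`. A subalgebra that fills `A` modulo the square of
a nilpotent ideal is all of `A`, so the ascending chain of the powers of `W` reaches `A`, and it
does so in at most `dim A - 1` steps because every step that enlarges the power raises the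
dimension. The general case follows by extending scalars to an algebraic closure of `𝔽_p`.
-/

/-! ### Powers of a subspace of a finite-dimensional algebra -/

section FiniteAlgebra

variable {F A : Type*} [Field F] [CommRing A] [Algebra F A]

/-- A subspace `V` with `A V = A` lies in no maximal ideal, and a vector space over an infinite field is not a
finite union of proper subspaces. -/
theorem exists_isUnit_mem_of_span_eq_top [Infinite F] [FiniteDimensional F A] (V : Submodule F A)
    (hV : Ideal.span (V : Set A) = ⊤) : ∃ u ∈ V, IsUnit u := by
  have : IsArtinianRing A := IsArtinianRing.of_finite F A
  by_contra! hu
  obtain ⟨P, hP⟩ := Subspace.exists_eq_top_of_iUnion_eq_univ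
    (p := fun P : MaximalSpectrum A => (P.asIdeal.restrictScalars F).comap V.subtype) (by
      refine Set.eq_univ_of_forall fun x => ?_
      obtain ⟨M, hM, hx⟩ := exists_max_ideal_of_mem_nonunits (hu x x.2)
      exact Set.mem_iUnion.2 ⟨⟨M, hM⟩, hx⟩)
  refine P.isMaximal.ne_top (top_le_iff.1 (hV ▸ Ideal.span_le.2 fun x hx => ?_))
  have : (⟨x, hx⟩ : V) ∈ (P.asIdeal.restrictScalars F).comap V.subtype := hP ▸ Submodule.mem_top
  exact this

/-- The chain `1 ≤ V ≤ V ^ 2 ≤ ⋯` is constant from its first repetition on, so before it reaches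
`⊤` every step raises the dimension. -/
theorem le_finrank_pow_or_pow_eq_top [FiniteDimensional F A] [Nontrivial A] {V : Submodule F A}
    (h1 : 1 ≤ V) {m : ℕ} (hm : V ^ m = ⊤) (k : ℕ) :
    V ^ k = ⊤ ∨ k + 1 ≤ Module.finrank F (V ^ k : Submodule F A) := by
  induction k with
  | zero =>
    right
    have : Nontrivial (V ^ 0 : Submodule F A) :=
      ⟨⟨⟨0, zero_mem _⟩, ⟨1, by rw [pow_zero]; exact Submodule.one_le.1 le_rfl⟩, by simp⟩⟩
    have := Module.finrank_pos (R := F) (M := (V ^ 0 : Submodule F A))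
    omega
  | succ k ih =>
    have hle : V ^ k ≤ V ^ (k + 1) := by
      rw [pow_succ]; simpa using mul_le_mul_right h1 (V ^ k)
    rcases ih with ih | ih
    · exact Or.inl (top_le_iff.1 (ih ▸ hle))
    rcases hle.eq_or_lt with h | h
    · left
      have hst : ∀ j, V ^ (k + j) = V ^ k := by
        intro j
        induction j with
        | zero => rfl
        | succ j ihj => rw [← add_assoc, pow_succ, ihj, ← pow_succ, ← h]
      rw [← h, ← hst m, pow_add, hm, eq_top_iff]
      calc ⊤ = 1 * (⊤ : Submodule F A) := (one_mul _).symm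
        _ ≤ V ^ k * ⊤ := mul_le_mul_left (one_le_pow_of_one_le' h1 k) _
    · right
      have := Submodule.finrank_lt_finrank_of_lt h
      omega

/-- A subspace containing `1` of which some power fills `A` modulo the square of a nilpotent ideal
`J` generates `A`: by the hypothesis `J` is generated by elements of `V ^ r` modulo `J ^ 2`, and so
`J ^ j` by elements of `V ^ (r * j)` modulo `J ^ (j + 1)`. -/
theorem exists_pow_eq_top_of_sup_sq {V : Submodule F A} (h1 : 1 ≤ V) {J : Ideal A} {N r : ℕ}
    (hJ : J ^ N = ⊥) (hr : ∀ x, ∃ v ∈ V ^ r, x - v ∈ J ^ 2) : ∃ m, V ^ m = ⊤ := by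
  have key : ∀ j, ∀ x ∈ J ^ (j + 1), ∃ v ∈ V ^ (r * (j + 1)), v ∈ J ^ (j + 1) ∧
      x - v ∈ J ^ (j + 2) := by
    intro j
    induction j with
    | zero =>
      intro x hx
      obtain ⟨v, hv, hxv⟩ := hr x
      refine ⟨v, by simpa using hv, ?_, hxv⟩
      have := sub_mem hx (Ideal.pow_le_pow_right (show 0 + 1 ≤ 2 by norm_num) hxv)
      simpa using this
    | succ j ih =>
      intro x hx
      rw [pow_succ] at hx
      refine Submodule.mul_induction_on hx (fun a ha b hb => ?_) (fun a b ha hb => ?_)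
      · obtain ⟨v, hv, hvJ, hav⟩ := ih a ha
        obtain ⟨w, hw, hbw⟩ := hr b
        have hwJ : w ∈ J := by
          have := sub_mem hb (Ideal.pow_le_self two_ne_zero hbw)
          simpa using this
        refine ⟨v * w, ?_, ?_, ?_⟩
        · rw [mul_add r, pow_add, mul_one]
          exact Submodule.mul_mem_mul hv hw
        · rw [pow_succ]
          exact Ideal.mul_mem_mul hvJ hwJ
        · have e : a * b - v * w = a * (b - w) + (a - v) * w := by ring
          rw [e]
          refine add_mem ?_ ?_
          · rw [show j + 1 + 2 = (j + 1) + 2 from rfl, pow_add]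
            exact Ideal.mul_mem_mul ha hbw
          · rw [show j + 1 + 2 = (j + 2) + 1 from rfl, pow_succ]
            exact Ideal.mul_mem_mul hav hwJ
      · obtain ⟨v, hv, hvJ, hav⟩ := ha
        obtain ⟨w, hw, hwJ, hbw⟩ := hb
        exact ⟨v + w, add_mem hv hw, add_mem hvJ hwJ, by
          rw [add_sub_add_comm]; exact add_mem hav hbw⟩
  have key2 : ∀ j, ∃ m, ∀ x, ∃ v ∈ V ^ m, x - v ∈ J ^ (j + 2) := by
    intro j
    induction j with
    | zero => exact ⟨r, hr⟩
    | succ j ih =>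
      obtain ⟨m, hm⟩ := ih
      refine ⟨m + r * (j + 2), fun x => ?_⟩
      obtain ⟨v, hv, hxv⟩ := hm x
      obtain ⟨w, hw, -, hvw⟩ := key (j + 1) _ hxv
      refine ⟨v + w, add_mem (pow_le_pow_right' h1 (Nat.le_add_right _ _) hv)
        (pow_le_pow_right' h1 (Nat.le_add_left _ _) hw), ?_⟩
      rw [← sub_sub]
      exact hvw
  obtain ⟨m, hm⟩ := key2 N
  refine ⟨m, eq_top_iff.2 fun x _ => ?_⟩
  obtain ⟨v, hv, hxv⟩ := hm x
  have h0 : x - v ∈ (⊥ : Ideal A) := hJ ▸ Ideal.pow_le_pow_right (by omega) hxv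
  rwa [sub_eq_zero.1 ((Submodule.mem_bot _).1 h0)]

theorem pow_eq_top_of_one_le [FiniteDimensional F A] {V : Submodule F A}
    (h1 : 1 ≤ V) {J : Ideal A} {N r : ℕ} (hJ : J ^ N = ⊥)
    (hr : ∀ x, ∃ v ∈ V ^ r, x - v ∈ J ^ 2) {s : ℕ} (hs : Module.finrank F A ≤ s + 1) :
    V ^ s = ⊤ := by
  nontriviality A
  obtain ⟨m, hm⟩ := exists_pow_eq_top_of_sup_sq h1 hJ hr
  rcases le_finrank_pow_or_pow_eq_top h1 hm s with h | h
  · exact h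
  · exact Submodule.eq_top_of_finrank_eq (le_antisymm (Submodule.finrank_le _) (hs.trans h))

/-- Dividing by a unit of `V` reduces to subspaces containing `1`. -/
theorem pow_eq_top_of_infinite [Infinite F] [FiniteDimensional F A] {V : Submodule F A}
    (hV : Ideal.span (V : Set A) = ⊤) {J : Ideal A} {N r : ℕ} (hJ : J ^ N = ⊥)
    (hr : ∀ x, ∃ v ∈ V ^ r, x - v ∈ J ^ 2) {s : ℕ} (hs : Module.finrank F A ≤ s + 1) :
    V ^ s = ⊤ := by
  obtain ⟨_, huV, u, rfl⟩ := exists_isUnit_mem_of_span_eq_top V hV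
  set W : Submodule F A := Submodule.span F {(↑u⁻¹ : A)} * V with hW
  have hmem : ∀ k, ∀ x, x ∈ W ^ k ↔ (u : A) ^ k * x ∈ V ^ k := by
    intro k x
    rw [hW, mul_pow, Submodule.span_pow, Set.singleton_pow, Submodule.mem_span_singleton_mul]
    constructor
    · rintro ⟨z, hz, rfl⟩
      rwa [← mul_assoc, ← mul_pow, Units.mul_inv, one_pow, one_mul]
    · intro h
      exact ⟨_, h, by rw [← mul_assoc, ← mul_pow, Units.inv_mul, one_pow, one_mul]⟩
  have h1 : 1 ≤ W := by
    rw [Submodule.one_le]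
    have := (hmem 1 1).2 (by simpa using huV)
    simpa using this
  have hWs : W ^ s = ⊤ := by
    refine pow_eq_top_of_one_le h1 hJ (r := r) (fun x => ?_) hs
    obtain ⟨v, hv, hxv⟩ := hr (u ^ r * x)
    refine ⟨↑u⁻¹ ^ r * v, (hmem _ _).2 ?_, ?_⟩
    · rwa [← mul_assoc, ← mul_pow, Units.mul_inv, one_pow, one_mul]
    · have := Ideal.mul_mem_left _ ((↑u⁻¹ : A) ^ r) hxv
      rwa [mul_sub, ← mul_assoc, ← mul_pow, Units.inv_mul, one_pow, one_mul] at this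
  refine eq_top_iff.2 fun x _ => ?_
  have := (hmem s (↑u⁻¹ ^ s * x)).1 (hWs ▸ Submodule.mem_top)
  rwa [← mul_assoc, ← mul_pow, Units.mul_inv, one_pow, one_mul] at this

open scoped Pointwise in
theorem span_image_includeRight_pow (k : Type*) [Field k] [Algebra F k] (V : Submodule F A)
    (r : ℕ) :
    Submodule.span k ((Algebra.TensorProduct.includeRight : A →ₐ[F] k ⊗[F] A) '' V) ^ r =
      Submodule.span k ((Algebra.TensorProduct.includeRight : A →ₐ[F] k ⊗[F] A) ''
        (V ^ r : Submodule F A)) := by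
  set φ : A →ₐ[F] k ⊗[F] A := Algebra.TensorProduct.includeRight
  rw [Submodule.span_pow, ← Set.image_pow φ]
  refine le_antisymm (Submodule.span_mono (Set.image_mono (Submodule.pow_subset_pow V))) ?_
  refine Submodule.span_le.2 ?_
  rintro _ ⟨x, hx, rfl⟩
  have h : (V ^ r : Submodule F A) ≤
      ((Submodule.span k (φ '' ((V : Set A) ^ r))).restrictScalars F).comap φ.toLinearMap := by
    conv_lhs => rw [← Submodule.span_eq V, Submodule.span_pow]
    exact Submodule.span_le.2 fun y hy => Submodule.subset_span ⟨y, hy, rfl⟩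
  exact h hx

/-- Descent of `U = ⊤` along an extension of the base field. -/
theorem eq_top_of_span_image_includeRight_eq_top (k : Type*) [Field k] [Algebra F k]
    (U : Submodule F A)
    (hU : Submodule.span k ((Algebra.TensorProduct.includeRight : A →ₐ[F] k ⊗[F] A) '' U) = ⊤) :
    U = ⊤ := by
  by_contra hne
  obtain ⟨f, hf, hle⟩ := Submodule.exists_le_ker_of_lt_top U (lt_top_iff_ne_top.2 hne)
  refine hf (LinearMap.ext fun x => ?_)
  have hker : (⊤ : Submodule k (k ⊗[F] A)) ≤ LinearMap.ker (f.baseChange k) := by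
    rw [← hU, Submodule.span_le]
    rintro _ ⟨y, hy, rfl⟩
    have : f y = 0 := hle hy
    simp [this]
  have h0 : f.baseChange k (1 ⊗ₜ x) = 0 := hker Submodule.mem_top
  rw [LinearMap.baseChange_tmul] at h0
  have := congrArg (TensorProduct.rid F k) h0
  simpa using this

/-- The bound on the exponent `s` depends only on the dimension of `A`, not on `r`. Over a small
field `V` may contain no unit, whence the passage to an algebraic closure. -/
theorem pow_eq_top_of_sup_sq [FiniteDimensional F A] {V : Submodule F A}
    (hV : Ideal.span (V : Set A) = ⊤) {J : Ideal A} {N r : ℕ} (hJ : J ^ N = ⊥)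
    (hr : ∀ x, ∃ v ∈ V ^ r, x - v ∈ J ^ 2) {s : ℕ} (hs : Module.finrank F A ≤ s + 1) :
    V ^ s = ⊤ := by
  let k := AlgebraicClosure F
  have : Infinite k := IsAlgClosed.instInfinite
  let φ : A →ₐ[F] k ⊗[F] A := Algebra.TensorProduct.includeRight
  refine eq_top_of_span_image_includeRight_eq_top k _ ?_
  rw [← span_image_includeRight_pow]
  refine pow_eq_top_of_infinite (J := J.map φ) (N := N) (r := r) ?_ ?_ ?_ ?_
  · rw [eq_top_iff, ← Ideal.map_top φ, ← hV, Ideal.map_span]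
    exact Ideal.span_mono Submodule.subset_span
  · rw [← Ideal.map_pow, hJ, Ideal.map_bot]
  · intro x
    rw [span_image_includeRight_pow]
    induction x with
    | zero => exact ⟨0, zero_mem _, by simp⟩
    | add x y hx hy =>
      obtain ⟨v, hv, hxv⟩ := hx
      obtain ⟨w, hw, hyw⟩ := hy
      exact ⟨v + w, add_mem hv hw, by rw [add_sub_add_comm]; exact add_mem hxv hyw⟩
    | tmul c x =>
      obtain ⟨v, hv, hxv⟩ := hr x
      refine ⟨c • φ v, Submodule.smul_mem _ _ (Submodule.subset_span ⟨v, hv, rfl⟩), ?_⟩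
      have e : c ⊗ₜ[F] x - c • φ v = (c ⊗ₜ[F] (1 : A)) * φ (x - v) := by
        simp [φ, TensorProduct.smul_tmul', ← TensorProduct.tmul_sub]
      rw [e, ← Ideal.map_pow]
      exact Ideal.mul_mem_left _ _ (Ideal.mem_map_of_mem φ hxv)
  · rw [Module.finrank_baseChange]; exact hs

end FiniteAlgebra

/-! ### Subgroups of a finite ring -/

section Order

/-- An idempotent subgroup `E` with `A E = A` contains `1`: it is an ideal of the ring `ℤ + E`, and
`E A = A` for the finite module `A` over that ring. -/
theorem one_mem_of_mul_self_eq {A : Type*} [CommRing A] [Module.Finite ℤ A] {E : Submodule ℤ A}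
    (hE : E * E = E) (hspan : Ideal.span (E : Set A) = ⊤) : (1 : A) ∈ E := by
  have hmul : ∀ x ∈ 1 ⊔ E, ∀ y ∈ E, x * y ∈ E := fun x hx y hy => by
    have h : (1 ⊔ E) * E ≤ E := by rw [Submodule.sup_mul, one_mul, hE, sup_idem]
    exact h (Submodule.mul_mem_mul hx hy)
  let B : Subalgebra ℤ A := (1 ⊔ E).toSubalgebra
    (le_sup_left (a := (1 : Submodule ℤ A)) (Submodule.one_le.1 le_rfl)) fun x y hx hy => by
      have h : (1 ⊔ E) * (1 ⊔ E) ≤ 1 ⊔ E := by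
        simp [Submodule.mul_sup, Submodule.sup_mul, hE]
      exact h (Submodule.mul_mem_mul hx hy)
  let I : Ideal B :=
    { carrier := {x | (x : A) ∈ E}
      add_mem' := fun hx hy => add_mem (S := Submodule ℤ A) hx hy
      zero_mem' := zero_mem E
      smul_mem' := fun x y hy => hmul x x.2 y hy }
  have htop : (⊤ : Submodule B A) ≤ I • (⊤ : Submodule B A) := by
    have h : ∀ x ∈ Ideal.span (E : Set A), ∀ a : A, a * x ∈ I • (⊤ : Submodule B A) := by
      intro x hx
      induction hx using Submodule.span_induction with
      | mem x hx =>
        intro a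
        have := Submodule.smul_mem_smul (I := I) (N := (⊤ : Submodule B A))
          (r := ⟨x, le_sup_right (a := (1 : Submodule ℤ A)) hx⟩) hx (Submodule.mem_top (x := a))
        rwa [mul_comm]
      | zero => intro a; simp
      | add x y _ _ hx hy => intro a; rw [mul_add]; exact add_mem (hx a) (hy a)
      | smul c x _ hx => intro a; rw [smul_eq_mul, ← mul_assoc]; exact hx _
    intro x _
    simpa using h 1 (hspan ▸ Submodule.mem_top) x
  have : Module.Finite B A := Module.Finite.of_restrictScalars_finite ℤ B A
  obtain ⟨e, he, h⟩ := Submodule.exists_mem_and_smul_eq_self_of_fg_of_le_smul I ⊤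
    Module.Finite.fg_top htop
  have h1 := h 1 Submodule.mem_top
  rw [Subalgebra.smul_def, smul_eq_mul, mul_one] at h1
  rw [← h1]
  exact he

theorem exists_pow_mul_self_eq {M : Type*} [Monoid M] [Finite M] (x : M) :
    ∃ m, 1 ≤ m ∧ x ^ m * x ^ m = x ^ m := by
  obtain ⟨i, j, hij, h⟩ := Finite.exists_ne_map_eq_of_infinite fun k : ℕ => x ^ (k + 1)
  wlog hlt : i < j generalizing i j
  · exact this j i hij.symm h.symm (lt_of_le_of_ne (not_lt.1 hlt) hij.symm)
  obtain ⟨d, rfl⟩ := Nat.exists_eq_add_of_lt hlt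
  have hper : ∀ k, x ^ (i + 1 + k + (d + 1)) = x ^ (i + 1 + k) := fun k => by
    rw [show i + 1 + k + (d + 1) = (i + d + 1 + 1) + k by ring, pow_add _ _ k, pow_add _ _ k]
    exact congrArg (· * x ^ k) h.symm
  have hmul : ∀ l k, x ^ (i + 1 + k + l * (d + 1)) = x ^ (i + 1 + k) := by
    intro l
    induction l with
    | zero => simp
    | succ l ih =>
      intro k
      rw [show i + 1 + k + (l + 1) * (d + 1) = i + 1 + (k + l * (d + 1)) + (d + 1) by ring, hper,
        ← add_assoc, ih]
  refine ⟨(i + 1) * (d + 1), Nat.mul_pos i.succ_pos d.succ_pos, ?_⟩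
  have := hmul (i + 1) ((i + 1) * d)
  rw [← pow_add]
  rwa [show i + 1 + (i + 1) * d = (i + 1) * (d + 1) by ring] at this

theorem span_pow_eq_top_of_span_eq_top {R A : Type*} [CommRing R] [CommRing A] [Algebra R A]
    {V : Submodule R A} (hV : Ideal.span (V : Set A) = ⊤) (m : ℕ) :
    Ideal.span ((V ^ m : Submodule R A) : Set A) = ⊤ := by
  induction m with
  | zero => exact (Ideal.eq_top_iff_one _).2 (Ideal.subset_span (by
      rw [pow_zero]; exact Submodule.one_le.1 le_rfl))
  | succ m ih =>
    rw [eq_top_iff, ← Ideal.one_eq_top, ← mul_one (1 : Ideal A), Ideal.one_eq_top]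
    nth_rw 1 [← ih]
    rw [← hV, Ideal.span_mul_span', Ideal.span_le]
    rintro _ ⟨x, hx, y, hy, rfl⟩
    refine Ideal.subset_span ?_
    rw [pow_succ]
    exact Submodule.mul_mem_mul hx hy

theorem exists_one_mem_pow {A : Type*} [CommRing A] [Finite A] {V : Submodule ℤ A}
    (hV : Ideal.span (V : Set A) = ⊤) : ∃ m, 1 ≤ m ∧ (1 : A) ∈ V ^ m ∧ V ^ m * V ^ m = V ^ m := by
  have : Finite (Submodule ℤ A) := Finite.of_injective _ SetLike.coe_injective
  obtain ⟨m, hm, h⟩ := exists_pow_mul_self_eq V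
  exact ⟨m, hm, one_mem_of_mul_self_eq h (span_pow_eq_top_of_span_eq_top hV m), h⟩

/-! ### Orders modulo `p` -/

variable {K : Type*} [Field K] [CharZero K]

theorem IsOrder.module_finite {O : Subalgebra ℤ K} (hO : IsOrder ℤ ℚ O) : Module.Finite ℤ O :=
  Module.Finite.iff_fg.2 hO.fg

theorem IsOrder.exists_basis [NumberField K] {O : Subalgebra ℤ K} (hO : IsOrder ℤ ℚ O) :
    ∃ (b : Module.Basis (Fin (Module.finrank ℚ K)) ℤ O)
      (c : Module.Basis (Fin (Module.finrank ℚ K)) ℚ K), ∀ i, c i = b i := by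
  have := hO.module_finite
  let b := Module.finBasis ℤ O
  have hli : LinearIndependent ℤ fun i => (b i : K) :=
    b.linearIndependent.map' O.val.toLinearMap (LinearMap.ker_eq_bot.2 Subtype.val_injective)
  have hsp : ⊤ ≤ Submodule.span ℚ (Set.range fun i => (b i : K)) := by
    rw [← hO.span_eq_top, Submodule.span_le]
    intro x hx
    have h := b.sum_repr ⟨x, hx⟩
    have h2 := congrArg O.val h
    rw [map_sum] at h2
    change _ = x at h2
    rw [← h2]
    refine sum_mem fun i _ => ?_
    rw [map_zsmul]
    exact zsmul_mem (Submodule.subset_span (Set.mem_range_self i)) _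
  let c := Module.Basis.mk ((LinearIndependent.iff_fractionRing ℤ ℚ).1 hli) hsp
  have hn : Module.finrank ℤ O = Module.finrank ℚ K := by
    rw [Module.finrank_eq_card_basis c, Fintype.card_fin]
  refine ⟨b.reindex (finCongr hn), c.reindex (finCongr hn), fun i => ?_⟩
  simp [c]

theorem IsOrder.finite_quotient {O : Subalgebra ℤ K} (hO : IsOrder ℤ ℚ O) {p : ℕ} (hp : p ≠ 0) :
    Finite (O ⧸ Ideal.span {(p : O)}) := by
  have := hO.module_finite
  have : Module.Finite ℤ (O ⧸ Ideal.span {(p : O)}) :=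
    Module.Finite.of_surjective (Ideal.Quotient.mkₐ ℤ _).toLinearMap
      (Ideal.Quotient.mkₐ_surjective ℤ _)
  have hp' : (p : ℤ) ∈ nonZeroDivisors ℤ := by simpa using hp
  refine Module.finite_of_fg_torsion (O ⧸ Ideal.span {(p : O)}) ?_
  intro x
  refine ⟨⟨(p : ℤ), hp'⟩, ?_⟩
  obtain ⟨x, rfl⟩ := Ideal.Quotient.mk_surjective x
  rw [Submonoid.mk_smul, natCast_zsmul, nsmul_eq_mul, ← map_natCast (Ideal.Quotient.mk _),
    ← map_mul]
  exact Ideal.Quotient.eq_zero_iff_mem.2 (Ideal.mul_mem_right _ _ (Ideal.mem_span_singleton_self _))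

/-- The primes over `(p)` are those containing `p`. -/
theorem pRadical_eq_radical {K : Type*} [Field K] {p : ℕ} (hp : p.Prime) (O : Subalgebra ℤ K) :
    pRadical p O = (Ideal.span {(p : O)}).radical := by
  rw [pRadical, Ideal.radical_eq_sInf]
  congr 1
  ext P
  have hmax : (Ideal.span {(p : ℤ)}).IsMaximal :=
    PrincipalIdealRing.isMaximal_of_irreducible (Nat.prime_iff_prime_int.1 hp).irreducible
  rw [Ideal.primesOver, Set.mem_ofPred_eq, Set.mem_ofPred_eq, Ideal.span_singleton_le_iff_mem]
  constructor
  · rintro ⟨h1, h2⟩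
    refine ⟨?_, h1⟩
    have := (Ideal.mem_of_liesOver P (Ideal.span {(p : ℤ)}) (p : ℤ)).1
      (Ideal.mem_span_singleton_self _)
    simpa using this
  · rintro ⟨h1, h2⟩
    refine ⟨h2, ⟨hmax.eq_of_le (Ideal.IsPrime.ne_top inferInstance) ?_⟩⟩
    rw [Ideal.span_singleton_le_iff_mem]
    simpa [Ideal.under] using h1

/-- `pow_eq_top_of_sup_sq` for the quotient `A = R / pR` over `ZMod p`, stated in `R`. The algebra
structure of the quotient enters as an arbitrary one on an isomorphic ring `A`. -/
theorem exists_mem_pow_sub_mem_of_surjective {p : ℕ} [Fact p.Prime] {R A : Type*} [CommRing R]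
    [CommRing A] [Algebra (ZMod p) A] (π : R →ₐ[ℤ] A) (hπ : Function.Surjective π)
    (hker : ∀ x, π x = 0 ↔ x ∈ Ideal.span {(p : R)}) {n : ℕ} {b : Fin n → R}
    (hb : Submodule.span ℤ (Set.range b) = ⊤) {J : Ideal R} {N : ℕ}
    (hN : J ^ N ≤ Ideal.span {(p : R)}) {W : Submodule ℤ R}
    (hW : Ideal.span (W : Set R) ⊔ Ideal.span {(p : R)} = ⊤) {r : ℕ}
    (hr : ∀ x, ∃ v ∈ W ^ r, x - v ∈ J ^ 2 ⊔ Ideal.span {(p : R)}) {s : ℕ}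
    (hs : n ≤ s + 1) (x : R) : ∃ v ∈ W ^ s, x - v ∈ Ideal.span {(p : R)} := by
  have hp0 : (p : A) = 0 := by
    rw [← map_natCast π]
    exact (hker _).2 (Ideal.mem_span_singleton_self _)
  let V : Submodule (ZMod p) A := Submodule.span (ZMod p) (W.map π.toLinearMap : Submodule ℤ A)
  have hV : ∀ k y, y ∈ V ^ k ↔ ∃ w ∈ W ^ k, π w = y := by
    intro k y
    have h : (V ^ k).restrictScalars ℤ = (W ^ k).map π.toLinearMap := by
      rw [Submodule.span_pow, Submodule.restrictScalars_span ℤ (ZMod p)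
        (ZMod.intCast_surjective (n := p)), ← Submodule.span_pow, Submodule.span_eq,
        Submodule.map_pow]
    rw [← Submodule.restrictScalars_mem ℤ, h]
    rfl
  have htop : Submodule.span (ZMod p) (Set.range fun i => π (b i)) = ⊤ := by
    refine eq_top_iff.2 fun y _ => ?_
    obtain ⟨y, rfl⟩ := hπ y
    have hy : y ∈ Submodule.span ℤ (Set.range b) := hb ▸ Submodule.mem_top
    rw [← Submodule.restrictScalars_mem ℤ, Submodule.restrictScalars_span ℤ (ZMod p)
        (ZMod.intCast_surjective (n := p))]
    have := Submodule.mem_map_of_mem (f := π.toLinearMap) hy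
    rwa [Submodule.map_span, ← Set.range_comp] at this
  have : FiniteDimensional (ZMod p) A := ⟨htop ▸ Submodule.fg_span (Set.finite_range _)⟩
  have hfin : Module.finrank (ZMod p) A ≤ s + 1 := by
    refine le_trans ?_ hs
    rw [← finrank_top (ZMod p) A, ← htop]
    exact (finrank_range_le_card _).trans (Fintype.card_fin _).le
  have key : V ^ s = ⊤ := by
    refine pow_eq_top_of_sup_sq (J := J.map π) (N := N) (r := r) ?_ ?_ ?_ hfin
    · rw [eq_top_iff, ← Ideal.map_top π, ← hW, Ideal.map_sup, Ideal.map_span, Ideal.map_span]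
      refine sup_le (Ideal.span_mono ?_) ?_
      · exact Submodule.subset_span
      · rw [Ideal.span_le, Set.image_singleton, Set.singleton_subset_iff, map_natCast, hp0]
        exact zero_mem _
    · rw [← Ideal.map_pow, eq_bot_iff, Ideal.map_le_iff_le_comap]
      exact fun y hy => (hker y).2 (hN hy)
    · intro y
      obtain ⟨y, rfl⟩ := hπ y
      obtain ⟨v, hv, hyv⟩ := hr y
      refine ⟨π v, (hV _ _).2 ⟨v, hv, rfl⟩, ?_⟩
      rw [← map_sub, ← Ideal.map_pow]
      obtain ⟨j, hj, t, ht, e⟩ := Submodule.mem_sup.1 hyv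
      rw [← e, map_add, (hker t).2 ht, add_zero]
      exact Ideal.mem_map_of_mem π hj
  obtain ⟨v, hv, h⟩ := (hV s (π x)).1 (key ▸ Submodule.mem_top)
  exact ⟨v, hv, (hker _).1 (by rw [map_sub, h, sub_self])⟩

theorem IsOrder.exists_pRadical_pow_le {O : Subalgebra ℤ K} (hO : IsOrder ℤ ℚ O) {p : ℕ}
    (hp : p.Prime) : ∃ N, pRadical p O ^ N ≤ Ideal.span {(p : O)} := by
  have := hO.module_finite
  have : IsNoetherianRing O := isNoetherian_of_tower ℤ inferInstance
  rw [pRadical_eq_radical hp]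
  exact Ideal.exists_radical_pow_le_of_fg _ (IsNoetherian.noetherian _)

theorem IsOrder.exists_mem_pow_sub_mem [NumberField K] {O : Subalgebra ℤ K}
    (hO : IsOrder ℤ ℚ O) {p : ℕ} [Fact p.Prime] {W : Submodule ℤ O}
    (hW : Ideal.span (W : Set O) ⊔ Ideal.span {(p : O)} = ⊤) {r : ℕ}
    (hr : ∀ x, ∃ v ∈ W ^ r, x - v ∈ pRadical p O ^ 2 ⊔ Ideal.span {(p : O)}) {s : ℕ}
    (hs : Module.finrank ℚ K ≤ s + 1) (x : O) :
    ∃ v ∈ W ^ s, x - v ∈ Ideal.span {(p : O)} := by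
  obtain ⟨N, hN⟩ := hO.exists_pRadical_pow_le (Fact.out : p.Prime)
  obtain ⟨b, -, -⟩ := hO.exists_basis
  rcases eq_or_ne (Ideal.span {(p : O)}) ⊤ with h | h
  · exact ⟨0, zero_mem _, h ▸ Submodule.mem_top⟩
  have : Nontrivial (O ⧸ Ideal.span {(p : O)}) := Ideal.Quotient.nontrivial_iff.2 h
  have hp0 : (p : O ⧸ Ideal.span {(p : O)}) = 0 := by
    rw [← map_natCast (Ideal.Quotient.mk _)]
    exact Ideal.Quotient.eq_zero_iff_mem.2 (Ideal.mem_span_singleton_self _)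
  have : CharP (O ⧸ Ideal.span {(p : O)}) p :=
    (CharP.charP_iff_prime_eq_zero Fact.out).2 hp0
  let : Algebra (ZMod p) (O ⧸ Ideal.span {(p : O)}) := ZMod.algebra _ p
  exact exists_mem_pow_sub_mem_of_surjective (Ideal.Quotient.mkₐ ℤ _)
    (Ideal.Quotient.mkₐ_surjective ℤ _) (fun x => Ideal.Quotient.eq_zero_iff_mem) b.span_eq hN hW
    hr hs x

end Order

/-! ### Invertible modules near `p` -/

section Invertible

variable {K : Type*} [Field K]

theorem mem_idealLattice {O : Subalgebra ℤ K} {b : Ideal O} {x : K} :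
    x ∈ idealLattice b ↔ ∃ y ∈ b, (y : K) = x := Iff.rfl

/-- If the product of the `R`-modules `M` and `N` is contained in none of finitely many maximal
ideals `P`, then a single `v ∈ M` works for all of them: `v N ⊈ P`. -/
theorem exists_mul_notMem_of_maximal {R : Subalgebra ℤ K} {M N : Submodule ℤ K}
    (hM : Subalgebra.toSubmodule R * M ≤ M) (hMN : M * N ≤ Subalgebra.toSubmodule R)
    (s : Finset (Ideal R)) (hs : ∀ P ∈ s, P.IsMaximal)
    (h : ∀ P ∈ s, ∃ z : R, (z : K) ∈ M * N ∧ z ∉ P) :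
    ∃ v ∈ M, ∀ P ∈ s, ∃ y ∈ N, ∃ z : R, (z : K) = v * y ∧ z ∉ P := by
  classical
  induction s using Finset.induction_on with
  | empty => exact ⟨0, zero_mem _, by simp⟩
  | insert P s hPs ih =>
    obtain ⟨v, hv, hvs⟩ := ih (fun Q hQ => hs Q (Finset.mem_insert_of_mem hQ))
      (fun Q hQ => h Q (Finset.mem_insert_of_mem hQ))
    have hP := hs P (Finset.mem_insert_self _ _)
    by_cases hvP : ∃ y ∈ N, ∃ z : R, (z : K) = v * y ∧ z ∉ P
    · exact ⟨v, hv, fun Q hQ => (Finset.mem_insert.1 hQ).elim (fun e => e ▸ hvP) (hvs Q)⟩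
    push Not at hvP
    obtain ⟨x, hx, y, hy, z, hz, hzP⟩ : ∃ x ∈ M, ∃ y ∈ N, ∃ z : R, (z : K) = x * y ∧ z ∉ P := by
      by_contra! hcon
      obtain ⟨z, hz, hzP⟩ := h P (Finset.mem_insert_self _ _)
      have hle : M * N ≤ idealLattice P := Submodule.mul_le.2 fun x hx y hy =>
        ⟨⟨x * y, hMN (Submodule.mul_mem_mul hx hy)⟩, hcon x hx y hy _ rfl, rfl⟩
      obtain ⟨w, hw, e⟩ := mem_idealLattice.1 (hle hz)
      exact hzP (Subtype.val_injective e ▸ hw)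
    obtain ⟨t, hts, htP⟩ : ∃ t ∈ s.inf id, t ∉ P := by
      refine SetLike.not_le_iff_exists.1 fun hle => ?_
      obtain ⟨Q, hQ, hQP⟩ := (Ideal.IsPrime.inf_le' hP.isPrime).1 hle
      have := (hs Q (Finset.mem_insert_of_mem hQ)).eq_of_le hP.ne_top hQP
      exact hPs (this ▸ hQ)
    have hmem : ∀ y ∈ N, v * y ∈ R := fun y hy => hMN (Submodule.mul_mem_mul hv hy)
    have hmem' : ∀ y ∈ N, x * y ∈ R := fun y hy => hMN (Submodule.mul_mem_mul hx hy)
    -- `t` vanishes in every ideal of `s`, where `v` is good already, and not in `P`, where `v` is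
    -- bad and `x` is good.
    refine ⟨v + t * x, add_mem hv (hM (Submodule.mul_mem_mul t.2 hx)), fun Q hQ => ?_⟩
    rcases Finset.mem_insert.1 hQ with rfl | hQ
    · refine ⟨y, hy, ⟨v * y, hmem y hy⟩ + t * z, ?_, fun hc => ?_⟩
      · change v * y + t * z = _
        rw [hz]; ring
      · have h1 := hvP y hy ⟨v * y, hmem y hy⟩ rfl
        exact (hP.isPrime.mem_or_mem ((Submodule.add_mem_iff_right _ h1).1 hc)).elim htP hzP
    · obtain ⟨y', hy', z', hz', hz'Q⟩ := hvs Q hQ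
      refine ⟨y', hy', z' + t * ⟨x * y', hmem' y' hy'⟩, ?_, fun hc => hz'Q ?_⟩
      · change (z' : K) + t * (x * y') = _
        rw [hz']; ring
      · have htQ : t ∈ Q := (Finset.inf_le (f := id) hQ : s.inf id ≤ Q) hts
        exact (Submodule.add_mem_iff_left _ (Q.mul_mem_right _ htQ)).1 hc

/-- If `M N` is the unit ideal of `R` near `p`, then some `v ∈ M` generates `M` near `p`:
it has an inverse `w ∈ N` up to a factor in `1 + pR`. -/
theorem IsOrder.exists_mul_eq_one_add [CharZero K] {R : Subalgebra ℤ K} (hR : IsOrder ℤ ℚ R)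
    {p : ℕ} (hp : p ≠ 0) {M N : Submodule ℤ K} (hM : Subalgebra.toSubmodule R * M ≤ M)
    (hN : Subalgebra.toSubmodule R * N ≤ N) (hMN : M * N ≤ Subalgebra.toSubmodule R)
    (h : ∀ P : Ideal R, P.IsMaximal → (p : R) ∈ P → ∃ z : R, (z : K) ∈ M * N ∧ z ∉ P) :
    ∃ v ∈ M, ∃ w ∈ N, ∃ t ∈ R, v * w = 1 + p * t := by
  have := hR.finite_quotient hp
  have hfin : {P : Ideal R | P.IsMaximal ∧ (p : R) ∈ P}.Finite := by
    have hf : Finite (Ideal (R ⧸ Ideal.span {(p : R)})) :=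
      Finite.of_injective _ SetLike.coe_injective
    refine (Set.finite_range (Ideal.comap (Ideal.Quotient.mk (Ideal.span {(p : R)})))).subset ?_
    rintro P ⟨-, hP⟩
    refine ⟨P.map (Ideal.Quotient.mk _), ?_⟩
    rw [Ideal.comap_map_of_surjective _ Ideal.Quotient.mk_surjective, ← RingHom.ker_eq_comap_bot,
      Ideal.mk_ker, sup_eq_left, Ideal.span_singleton_le_iff_mem]
    exact hP
  obtain ⟨v, hv, hvP⟩ := exists_mul_notMem_of_maximal hM hMN hfin.toFinset
    (fun P hP => (hfin.mem_toFinset.1 hP).1)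
    (fun P hP => h P (hfin.mem_toFinset.1 hP).1 (hfin.mem_toFinset.1 hP).2)
  let Q : Ideal R :=
    { carrier := {z | ∃ y ∈ N, (z : K) = v * y}
      add_mem' := by
        rintro a b ⟨y, hy, hay⟩ ⟨y', hy', hby⟩
        exact ⟨y + y', add_mem hy hy', by rw [mul_add, ← hay, ← hby]; rfl⟩
      zero_mem' := ⟨0, zero_mem _, by simp⟩
      smul_mem' := by
        rintro c a ⟨y, hy, hay⟩
        refine ⟨c * y, hN (Submodule.mul_mem_mul c.2 hy), ?_⟩
        rw [smul_eq_mul, mul_left_comm, ← hay]; rfl }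
  have htop : Q ⊔ Ideal.span {(p : R)} = ⊤ := by
    by_contra hne
    obtain ⟨P, hP, hle⟩ := Ideal.exists_le_maximal _ hne
    have hpP : (p : R) ∈ P := hle (Ideal.mem_sup_right (Ideal.mem_span_singleton_self _))
    obtain ⟨y, hy, z, hz, hzP⟩ := hvP P (hfin.mem_toFinset.2 ⟨hP, hpP⟩)
    exact hzP (hle (Ideal.mem_sup_left ⟨y, hy, hz⟩))
  obtain ⟨z, ⟨y, hy, hz⟩, t, ht, e⟩ := Submodule.mem_sup.1 (htop ▸ Submodule.mem_top (x := (1 : R)))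
  obtain ⟨t, rfl⟩ := Ideal.mem_span_singleton'.1 ht
  refine ⟨v, hv, y, hy, -t, neg_mem t.2, ?_⟩
  have e' : (z : K) + t * p = 1 := by exact_mod_cast congrArg (Subtype.val) e
  rw [← hz, ← e']; ring

/-- Nakayama's lemma `N = M + pN → N ≤ M`, elementary when a power of `p` maps `N` to `M`. -/
theorem mem_of_forall_exists_add_mul {M N : Submodule ℤ K} {p k : ℕ}
    (h : ∀ x ∈ N, ∃ y ∈ M, ∃ z ∈ N, x = y + p * z) (hk : ∀ x ∈ N, (p : K) ^ k * x ∈ M) :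
    N ≤ M := by
  have key : ∀ k : ℕ, ∀ x ∈ N, ∃ y ∈ M, ∃ z ∈ N, x = y + (p : K) ^ k * z := by
    intro k
    induction k with
    | zero => exact fun x hx => ⟨0, zero_mem _, x, hx, by simp⟩
    | succ k ih =>
      intro x hx
      obtain ⟨y, hy, z, hz, rfl⟩ := ih x hx
      obtain ⟨y', hy', z', hz', rfl⟩ := h z hz
      refine ⟨y + (p : K) ^ k * y', add_mem hy ?_, z', hz', by ring⟩
      have := M.smul_mem ((p : ℤ) ^ k) hy'
      rwa [zsmul_eq_mul, Int.cast_pow, Int.cast_natCast] at this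
  intro x hx
  obtain ⟨y, hy, z, hz, rfl⟩ := key k x hx
  exact add_mem hy (hk z hz)

theorem HasPPowerIndex.exists_pow_mul_mem {p : ℕ} {O : Subalgebra ℤ K} {I : Submodule ℤ K}
    (h : HasPPowerIndex p O I) : ∃ k, ∀ x ∈ O, (p : K) ^ k * x ∈ I := by
  obtain ⟨-, k, hk⟩ := h
  refine ⟨k, fun x hx => ?_⟩
  have := AddSubgroup.nsmul_relIndex_mem I.toAddSubgroup
    (K := (Subalgebra.toSubmodule O).toAddSubgroup) hx
  rw [hk, nsmul_eq_mul, Nat.cast_pow] at this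
  exact this

theorem pow_mul_mem_pow {p k : ℕ} {O : Subalgebra ℤ K} {I : Submodule ℤ K}
    (hk : ∀ x ∈ O, (p : K) ^ k * x ∈ I) {s : ℕ} (hs : s ≠ 0) :
    ∀ x ∈ O, (p : K) ^ (k * s) * x ∈ I ^ s := by
  obtain ⟨s, rfl⟩ := Nat.exists_eq_succ_of_ne_zero hs
  clear hs
  induction s with
  | zero => simpa using hk
  | succ s ih =>
    intro x hx
    rw [pow_succ I (s + 1), Nat.mul_succ, pow_add (p : K)]
    have := Submodule.mul_mem_mul (ih 1 O.one_mem) (hk x hx)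
    rwa [mul_one, ← mul_assoc] at this

theorem toSubmodule_mul_self (O : Subalgebra ℤ K) :
    Subalgebra.toSubmodule O * Subalgebra.toSubmodule O = Subalgebra.toSubmodule O :=
  O.isIdempotentElem_toSubmodule

theorem toSubmodule_pow (O : Subalgebra ℤ K) {s : ℕ} (hs : s ≠ 0) :
    Subalgebra.toSubmodule O ^ s = Subalgebra.toSubmodule O :=
  O.isIdempotentElem_toSubmodule.pow_eq hs

theorem isFullLattice_of_mul_mem [CharZero K] {O : Subalgebra ℤ K} (hO : IsOrder ℤ ℚ O)
    {M : Submodule ℤ K} (hM : M.FG) {c : K} (hc : c ≠ 0) (h : ∀ x ∈ O, c * x ∈ M) :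
    IsFullLattice ℤ ℚ M := by
  refine ⟨hM, eq_top_iff.2 fun x _ => ?_⟩
  have hle : Submodule.span ℚ (Subalgebra.toSubmodule O : Set K) ≤
      (Submodule.span ℚ (M : Set K)).comap (LinearMap.mulLeft ℚ c) :=
    Submodule.span_le.2 fun y hy => Submodule.subset_span (h y hy)
  have := hle (hO.span_eq_top ▸ Submodule.mem_top (x := c⁻¹ * x))
  rwa [Submodule.mem_comap, LinearMap.mulLeft_apply, mul_inv_cancel_left₀ hc] at this

/-- The hypotheses `p ∈ a ≤ O` serve only to show that the powers of `a` and of its inverse span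
`K` over `ℚ`. -/
theorem IsInvertibleIdeal.pow [CharZero K] {O : Subalgebra ℤ K} (hO : IsOrder ℤ ℚ O) {p : ℕ}
    (hp : p ≠ 0) {a : Submodule ℤ K} (ha : IsInvertibleIdeal O a) (hpa : (p : K) ∈ a)
    (haO : a ≤ Subalgebra.toSubmodule O) {s : ℕ} (hs : s ≠ 0) : IsInvertibleIdeal O (a ^ s) := by
  obtain ⟨⟨hal, ham⟩, X, ⟨hXl, hXm⟩, haX⟩ := ha
  have hpow : ∀ M : Submodule ℤ K, M * Subalgebra.toSubmodule O ≤ M →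
      M ^ s * Subalgebra.toSubmodule O ≤ M ^ s := fun M hM => by
    nth_rw 1 [← toSubmodule_pow O hs]
    rw [← mul_pow]
    exact pow_le_pow_left' hM s
  have hOX : Subalgebra.toSubmodule O ≤ X := by
    rw [← haX, mul_comm]
    exact (mul_le_mul_right haO X).trans hXm
  have hp' : (p : K) ≠ 0 := Nat.cast_ne_zero.2 hp
  refine ⟨⟨isFullLattice_of_mul_mem hO (hal.fg.pow s) (pow_ne_zero s hp')
    fun x hx => ?_, hpow a ham⟩, X ^ s,
    ⟨isFullLattice_of_mul_mem hO (hXl.fg.pow s) one_ne_zero fun x hx => ?_, hpow X hXm⟩, ?_⟩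
  · exact hpow a ham (Submodule.mul_mem_mul (Submodule.pow_mem_pow _ hpa s) hx)
  · rw [one_mul]
    have := pow_le_pow_left' hOX s
    rw [toSubmodule_pow O hs] at this
    exact this hx
  · rw [← mul_pow, haX, toSubmodule_pow O hs]

theorem sup_mul_pow_le {I a b : Submodule ℤ K} (hI : I ≤ a) (hb : b * b ≤ b) (r : ℕ) :
    (I ⊔ a * b) ^ r ≤ I ^ r ⊔ a ^ r * b := by
  induction r with
  | zero => simp
  | succ r ih =>
    rw [pow_succ]
    refine (mul_le_mul_left ih _).trans ?_
    rw [Submodule.sup_mul, Submodule.mul_sup, Submodule.mul_sup]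
    have h1 : I ^ r ≤ a ^ r := pow_le_pow_left' hI r
    refine sup_le (sup_le ?_ ?_) (sup_le ?_ ?_)
    · rw [← pow_succ]; exact le_sup_left
    · refine le_sup_of_le_right ?_
      rw [pow_succ, ← mul_assoc]
      exact mul_le_mul_left (mul_le_mul_left h1 _) _
    · refine le_sup_of_le_right ?_
      rw [pow_succ, mul_right_comm]
      exact mul_le_mul_left (mul_le_mul_right hI _) _
    · refine le_sup_of_le_right ?_
      rw [pow_succ, mul_mul_mul_comm]
      exact mul_le_mul_right hb _

end Invertible

/-! ### Powers of a lattice in an invertible ideal -/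

section Cond

variable {K : Type*} [Field K]

theorem pow_eq_mul_toSubmodule_pow {O : Subalgebra ℤ K} {M : Submodule ℤ K} {r : ℕ}
    (h : M ^ r * Subalgebra.toSubmodule O ≤ M ^ r) (hr : r ≠ 0) :
    M ^ r = (M * Subalgebra.toSubmodule O) ^ r := by
  rw [mul_pow, toSubmodule_pow O hr]
  refine le_antisymm ?_ h
  simpa using mul_le_mul_right (Submodule.one_le.2 O.one_mem) (M ^ r)

theorem exists_one_add_mul_pow {O : Subalgebra ℤ K} {t : K} (ht : t ∈ O) (p k : ℕ) :
    ∃ t' ∈ O, (1 + p * t) ^ k = 1 + p * t' := by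
  induction k with
  | zero => exact ⟨0, zero_mem _, by simp⟩
  | succ k ih =>
    obtain ⟨t', ht', e⟩ := ih
    refine ⟨t + t' + p * (t * t'), add_mem (add_mem ht ht')
      (O.mul_mem (natCast_mem O p) (O.mul_mem ht ht')), ?_⟩
    rw [pow_succ, e]; ring

theorem idealLattice_le {O : Subalgebra ℤ K} (b : Ideal O) :
    idealLattice b ≤ Subalgebra.toSubmodule O := by
  rintro _ ⟨x, -, rfl⟩
  exact x.2

theorem toSubmodule_mul_idealLattice_le {O : Subalgebra ℤ K} (b : Ideal O) :
    Subalgebra.toSubmodule O * idealLattice b ≤ idealLattice b := by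
  refine Submodule.mul_le.2 ?_
  rintro x hx _ ⟨y, hy, rfl⟩
  exact ⟨⟨x, hx⟩ * y, b.mul_mem_left _ hy, rfl⟩

/-- If some power of `I' = I + ab` is the power of `a`, then `I ^ s = a ^ s` already for every
`s ≥ n - 1`. The exponent `r` plays no role in the bound. -/
theorem pow_le_of_pow_eq_pow [NumberField K] {p : ℕ} [Fact p.Prime] {O : Subalgebra ℤ K}
    (hO : IsOrder ℤ ℚ O) {I a I' : Submodule ℤ K} {b : Ideal O} (hI : HasPPowerIndex p O I)
    (ha : a = I * Subalgebra.toSubmodule O) (hinv : IsInvertibleIdeal O a)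
    (haO : a ≤ Subalgebra.toSubmodule O) (hb : b ≤ pRadical p O ^ 2 ⊔ Ideal.span {(p : O)})
    (hI' : I' = I ⊔ a * idealLattice b) {r : ℕ} (hr : r ≠ 0) (h : I' ^ r = a ^ r) {s : ℕ}
    (hs : s ≠ 0) (hn : Module.finrank ℚ K ≤ s + 1) : a ^ s ≤ I ^ s := by
  obtain ⟨⟨hal, ham⟩, X, ⟨hXl, hXm⟩, haX⟩ := hinv
  rw [mul_comm] at ham hXm
  have hIa : I ≤ a := by
    rw [ha]; simpa using mul_le_mul_right (Submodule.one_le.2 O.one_mem) I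
  have hpow : ∀ k, k ≠ 0 → a ^ k * X ^ k = Subalgebra.toSubmodule O := fun k hk => by
    rw [← mul_pow, haX, toSubmodule_pow O hk]
  obtain ⟨α, hα, ξ, hξ, t, ht, hαξ⟩ := hO.exists_mul_eq_one_add (Fact.out : p.Prime).ne_zero
    ham hXm haX.le fun P hP _ => ⟨1, haX ▸ O.one_mem, fun h1 =>
      hP.ne_top ((Ideal.eq_top_iff_one _).2 h1)⟩
  have hξa : ∀ k, k ≠ 0 → ∀ z ∈ a ^ k, ξ ^ k * z ∈ O := fun k hk z hz => by
    have := Submodule.mul_mem_mul hz (Submodule.pow_mem_pow X hξ k)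
    rwa [hpow k hk, mul_comm] at this
  -- `ξ` inverts the generator `α` of `a` near `p`, and `W = ξ I`.
  let W : Submodule ℤ O := (Submodule.span ℤ {ξ} * I).comap O.val.toLinearMap
  have hmap : W.map O.val.toLinearMap = Submodule.span ℤ {ξ} * I := by
    refine Submodule.map_comap_eq_of_le fun x hx => ?_
    obtain ⟨z, hz, rfl⟩ := Submodule.mem_span_singleton_mul.1 hx
    refine ⟨⟨ξ * z, ?_⟩, rfl⟩
    simpa using hξa 1 one_ne_zero z (by simpa using hIa hz)
  have hWpow : ∀ k (x : O), x ∈ W ^ k ↔ ∃ i ∈ I ^ k, ξ ^ k * i = x := fun k x => by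
    rw [← Submodule.mem_span_singleton_mul, ← Set.singleton_pow, ← Submodule.span_pow, ← mul_pow,
      ← hmap, ← Submodule.map_pow]
    constructor
    · exact fun hx => ⟨x, hx, rfl⟩
    · rintro ⟨y, hy, e⟩
      exact Subtype.val_injective e ▸ hy
  have hW : Ideal.span (W : Set O) ⊔ Ideal.span {(p : O)} = ⊤ := by
    have hle : Submodule.span ℤ {ξ} * a ≤ idealLattice (Ideal.span (W : Set O)) := by
      rw [ha, ← mul_assoc, ← hmap, Submodule.mul_le]
      rintro _ ⟨w, hw, rfl⟩ y hy
      exact ⟨w * ⟨y, hy⟩, Ideal.mul_mem_right _ _ (Ideal.subset_span hw), rfl⟩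
    obtain ⟨w, hw, e⟩ := mem_idealLattice.1
      (hle (Submodule.mul_mem_mul (Submodule.mem_span_singleton_self ξ) hα))
    rw [Ideal.eq_top_iff_one, Submodule.mem_sup]
    refine ⟨w, hw, -(⟨t, ht⟩ * (p : O)), neg_mem (Ideal.mul_mem_left _ _
      (Ideal.mem_span_singleton_self _)), Subtype.val_injective ?_⟩
    change (w : K) + -(t * ((p : O) : K)) = 1
    rw [e, mul_comm ξ, hαξ]
    push_cast
    ring
  have hWr : ∀ x, ∃ v ∈ W ^ r, x - v ∈ pRadical p O ^ 2 ⊔ Ideal.span {(p : O)} := by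
    intro x
    obtain ⟨t', ht', e⟩ := exists_one_add_mul_pow ht p r
    have hx : (x : K) * α ^ r ∈ I ^ r ⊔ a ^ r * idealLattice b := by
      refine sup_mul_pow_le hIa ?_ r ?_
      · exact (mul_le_mul_left (idealLattice_le b) _).trans (toSubmodule_mul_idealLattice_le b)
      · rw [← hI', h, ← Nat.succ_pred_eq_of_ne_zero hr, pow_succ' a, pow_succ' α, ← mul_assoc]
        exact Submodule.mul_mem_mul (ham (Submodule.mul_mem_mul x.2 hα))
          (Submodule.pow_mem_pow a hα _)
    obtain ⟨i, hi, c, hc, hic⟩ := Submodule.mem_sup.1 hx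
    have hcb : ξ ^ r * c ∈ idealLattice b := by
      have := Submodule.mul_mem_mul (Submodule.pow_mem_pow X hξ r) hc
      rw [← mul_assoc, mul_comm (X ^ r), hpow r hr] at this
      exact toSubmodule_mul_idealLattice_le b this
    obtain ⟨β, hβ, hβc⟩ := mem_idealLattice.1 hcb
    have hiO : ξ ^ r * i ∈ O := hξa r hr i (pow_le_pow_left' hIa r hi)
    refine ⟨⟨ξ ^ r * i, hiO⟩, (hWpow _ _).2 ⟨i, hi, rfl⟩, ?_⟩
    have e2 : x - ⟨ξ ^ r * i, hiO⟩ = β - ⟨t', ht'⟩ * x * (p : O) := by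
      refine Subtype.val_injective ?_
      change (x : K) - ξ ^ r * i = β - t' * x * ((p : O) : K)
      rw [hβc]
      push_cast
      have e3 : (x : K) * (α * ξ) ^ r = ξ ^ r * i + ξ ^ r * c := by
        rw [mul_pow, ← mul_add, hic]; ring
      rw [hαξ, e] at e3
      linear_combination e3
    rw [e2]
    exact sub_mem (hb hβ) (Ideal.mem_sup_right (Ideal.mul_mem_left _ _
      (Ideal.mem_span_singleton_self _)))
  obtain ⟨k, hk⟩ := hI.exists_pow_mul_mem
  have haOs : a ^ s ≤ Subalgebra.toSubmodule O := by
    have := pow_le_pow_left' haO s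
    rwa [toSubmodule_pow O hs] at this
  have hOas : ∀ x ∈ O, ∀ z ∈ a ^ s, x * z ∈ a ^ s := fun x hx z hz => by
    have h1 : Subalgebra.toSubmodule O * a ^ s ≤ a ^ s := by
      -- `a` absorbs `O`, and `s ≠ 0` provides a factor `a`.
      rw [← Nat.succ_pred_eq_of_ne_zero hs, pow_succ', ← mul_assoc]
      exact mul_le_mul_left ham _
    exact h1 (Submodule.mul_mem_mul hx hz)
  refine mem_of_forall_exists_add_mul (p := p) (k := k * s) (fun z hz => ?_)
    fun x hx => pow_mul_mem_pow hk hs x (haOs hx)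
  obtain ⟨v, hv, hxv⟩ := hO.exists_mem_pow_sub_mem hW hWr hn ⟨ξ ^ s * z, hξa s hs z hz⟩
  obtain ⟨i, hi, hiv⟩ := (hWpow s v).1 hv
  obtain ⟨τ, hτ⟩ := Ideal.mem_span_singleton'.1 hxv
  obtain ⟨t', ht', e⟩ := exists_one_add_mul_pow ht p s
  have hτ' : (τ : K) * p = ξ ^ s * z - v := by
    have := congrArg Subtype.val hτ
    push_cast at this
    exact this
  refine ⟨i, hi, t' * (i - z) + τ * α ^ s, add_mem (hOas _ ht' _ (sub_mem ?_ hz))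
    (hOas _ τ.2 _ (Submodule.pow_mem_pow a hα s)), ?_⟩
  · exact pow_le_pow_left' hIa s hi
  · rw [← hαξ, mul_pow] at e
    rw [← hiv] at hτ'
    linear_combination (i - z) * e - α ^ s * hτ'

theorem satisfiesCond_iff [NumberField K] {p : ℕ} [Fact p.Prime] {O : Subalgebra ℤ K}
    (hO : IsOrder ℤ ℚ O) {I a I' : Submodule ℤ K} {b : Ideal O} (hI : HasPPowerIndex p O I)
    (hpI : (p : K) ∈ I) (ha : a = I * Subalgebra.toSubmodule O)
    (haJ : a ≤ idealLattice (pRadical p O)) (hinv : IsInvertibleIdeal O a)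
    (hb : b ≤ pRadical p O ^ 2 ⊔ Ideal.span {(p : O)}) (hab : a ^ 2 * idealLattice b ≤ I)
    (hI' : I' = I ⊔ a * idealLattice b) :
    SatisfiesCond p O I ↔ SatisfiesCond p O I' ∧ I' ^ 2 ≤ I := by
  have hIa : I ≤ a := by
    rw [ha]; simpa using mul_le_mul_right (Submodule.one_le.2 O.one_mem) I
  have haO : a ≤ Subalgebra.toSubmodule O := haJ.trans (idealLattice_le _)
  have hII' : I ≤ I' := hI' ▸ le_sup_left
  have haOa : a * Subalgebra.toSubmodule O ≤ a := hinv.1.2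
  have hI'a : I' ≤ a := by
    rw [hI']
    exact sup_le hIa ((mul_le_mul_right (idealLattice_le b) a).trans haOa)
  have hbb : idealLattice b * idealLattice b ≤ idealLattice b :=
    (mul_le_mul_left (idealLattice_le b) _).trans (toSubmodule_mul_idealLattice_le b)
  constructor
  · rintro ⟨-, hsq, -, r, hr1, hrn, hr⟩
    have hr0 : r ≠ 0 := Nat.one_le_iff_ne_zero.1 hr1
    have hsq' : I' ^ 2 ≤ I := by
      rw [hI']
      exact (sup_mul_pow_le hIa hbb 2).trans (sup_le hsq hab)
    have hIr : I ^ r = a ^ r := by rw [ha]; exact pow_eq_mul_toSubmodule_pow hr.1.2 hr0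
    have hI'r : I' ^ r = I ^ r :=
      le_antisymm (hIr ▸ pow_le_pow_left' hI'a r) (pow_le_pow_left' hII' r)
    exact ⟨⟨hII' hpI, hsq'.trans hII', hI'a.trans haJ, r, hr1, hrn, hI'r ▸ hr⟩, hsq'⟩
  · rintro ⟨⟨-, -, -, r, hr1, hrn, hr⟩, hsq'⟩
    have hr0 : r ≠ 0 := Nat.one_le_iff_ne_zero.1 hr1
    have hI'O : I' * Subalgebra.toSubmodule O = a :=
      le_antisymm ((mul_le_mul_left hI'a _).trans haOa) (ha ▸ mul_le_mul_left hII' _)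
    have hI'r : I' ^ r = a ^ r := by
      rw [← hI'O]; exact pow_eq_mul_toSubmodule_pow hr.1.2 hr0
    have hn0 : Module.finrank ℚ K - 1 ≠ 0 := by omega
    have hle := pow_le_of_pow_eq_pow hO hI ha hinv haO hb hI' hr0 hI'r hn0 (by omega)
    refine ⟨hpI, (pow_le_pow_left' hII' 2).trans hsq', hIa.trans haJ,
      Module.finrank ℚ K - 1, by omega, by omega, ?_⟩
    rw [le_antisymm (pow_le_pow_left' hIa _) hle]
    exact hinv.pow hO (Fact.out : p.Prime).ne_zero (hIa hpI) haO hn0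

end Cond

/-! ### Completions of orders -/

section Completion

variable {K : Type*} [Field K] [CharZero K] (p : ℕ) [Fact p.Prime]

variable {p} in
theorem completion_le {M : Submodule ℤ K} {N : Submodule ℤ_[p] (ℚ_[p] ⊗[ℚ] K)}
    (h : ∀ x ∈ M, (1 : ℚ_[p]) ⊗ₜ[ℚ] x ∈ N) : completion p M ≤ N := by
  refine Submodule.span_le.2 ?_
  rintro _ ⟨x, hx, rfl⟩
  exact h x hx

theorem tmul_mem_completion {M : Submodule ℤ K} {x : K} (hx : x ∈ M) :
    (1 : ℚ_[p]) ⊗ₜ[ℚ] x ∈ completion p M :=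
  Submodule.subset_span ⟨x, hx, rfl⟩

theorem tmul_mem_completedOrder {O : Subalgebra ℤ K} {x : K} (hx : x ∈ O) :
    (1 : ℚ_[p]) ⊗ₜ[ℚ] x ∈ completedOrder p O :=
  tmul_mem_completion p (M := Subalgebra.toSubmodule O) hx

variable {p} in
theorem completedOrder_le {O : Subalgebra ℤ K} {N : Submodule ℤ_[p] (ℚ_[p] ⊗[ℚ] K)}
    (h : ∀ x ∈ O, (1 : ℚ_[p]) ⊗ₜ[ℚ] x ∈ N) : Subalgebra.toSubmodule (completedOrder p O) ≤ N :=
  completion_le (M := Subalgebra.toSubmodule O) h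

theorem completedOrder_mono {S O : Subalgebra ℤ K} (h : S ≤ O) :
    completedOrder p S ≤ completedOrder p O :=
  completedOrder_le (N := Subalgebra.toSubmodule (completedOrder p O)) fun _ hx =>
    tmul_mem_completedOrder p (h hx)

theorem IsOrder.completedOrder {O : Subalgebra ℤ K} (hO : IsOrder ℤ ℚ O) :
    IsOrder ℤ_[p] ℚ_[p] (completedOrder p O) := by
  constructor
  · obtain ⟨s, hs⟩ := hO.fg
    refine Submodule.fg_def.2 ⟨(fun x => (1 : ℚ_[p]) ⊗ₜ[ℚ] x) '' (s : Set K),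
      s.finite_toSet.image _, le_antisymm ?_ ?_⟩
    · rw [Submodule.span_le]
      rintro _ ⟨x, hx, rfl⟩
      exact tmul_mem_completion p (hs ▸ Submodule.subset_span hx)
    · refine completedOrder_le fun x hx => ?_
      have hx' : x ∈ Submodule.span ℤ (s : Set K) := hs ▸ hx
      clear hx
      induction hx' using Submodule.span_induction with
      | mem x hx => exact Submodule.subset_span ⟨x, hx, rfl⟩
      | zero => rw [TensorProduct.tmul_zero]; exact zero_mem _
      | add x y _ _ hx hy => rw [TensorProduct.tmul_add]; exact add_mem hx hy
      | smul c x _ hx =>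
        rw [← TensorProduct.smul_tmul, ← TensorProduct.smul_tmul']
        exact zsmul_mem hx c
  · rw [Submodule.eq_top_iff']
    intro y
    induction y with
    | zero => exact zero_mem _
    | add x y hx hy => exact add_mem hx hy
    | tmul c x =>
      rw [← mul_one c, ← smul_eq_mul, ← TensorProduct.smul_tmul']
      refine Submodule.smul_mem _ _ ?_
      have hx : x ∈ Submodule.span ℚ (Subalgebra.toSubmodule O : Set K) :=
        hO.span_eq_top ▸ Submodule.mem_top
      induction hx using Submodule.span_induction with
      | mem x hx => exact Submodule.subset_span (tmul_mem_completion p hx)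
      | zero => rw [TensorProduct.tmul_zero]; exact zero_mem _
      | add x y _ _ hx hy => rw [TensorProduct.tmul_add]; exact add_mem hx hy
      | smul c x _ hx =>
        rw [← TensorProduct.smul_tmul, ← TensorProduct.smul_tmul', ← algebraMap_smul ℚ_[p] c]
        exact Submodule.smul_mem _ _ hx

/-- Elements of `1 + pS` are units of `S_p`, as `p` lies in every maximal ideal of `S_p`. -/
theorem exists_one_add_mul_tmul_mul_eq_one {S : Subalgebra ℤ K} (hS : IsOrder ℤ ℚ S) {t : K}
    (ht : t ∈ S) :
    ∃ y ∈ completedOrder p S, (1 : ℚ_[p]) ⊗ₜ[ℚ] (1 + p * t) * y = 1 := by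
  have : Module.Finite ℤ_[p] (completedOrder p S) :=
    Module.Finite.iff_fg.2 (hS.completedOrder p).fg
  have hint : Algebra.IsIntegral ℤ_[p] (completedOrder p S) := inferInstance
  let τ : completedOrder p S := ⟨_, tmul_mem_completedOrder p ht⟩
  have hu : IsUnit (1 + (p : completedOrder p S) * τ) := by
    by_contra hn
    obtain ⟨Q, hQ, hmem⟩ := exists_max_ideal_of_mem_nonunits hn
    have hmax := Ideal.isMaximal_comap_of_isIntegral_of_isMaximal (R := ℤ_[p]) Q
    have hp : (p : ℤ_[p]) ∈ Q.comap (algebraMap ℤ_[p] (completedOrder p S)) := by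
      rw [IsLocalRing.eq_maximalIdeal hmax, PadicInt.maximalIdeal_eq_span_p]
      exact Ideal.mem_span_singleton_self _
    rw [Ideal.mem_comap, map_natCast] at hp
    exact hQ.ne_top ((Ideal.eq_top_iff_one _).2
      ((Submodule.add_mem_iff_left _ (Q.mul_mem_right τ hp)).1 hmem))
  obtain ⟨y, hy⟩ := hu.exists_right_inv
  refine ⟨y, y.2, ?_⟩
  have h := congrArg Subtype.val hy
  have e : (1 : ℚ_[p]) ⊗ₜ[ℚ] (1 + p * t : K) =
      ((1 + (p : completedOrder p S) * τ : completedOrder p S) : ℚ_[p] ⊗[ℚ] K) := by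
    push_cast
    rw [TensorProduct.tmul_add, ← Algebra.TensorProduct.one_def]
    congr 1
    rw [← nsmul_eq_mul, ← nsmul_eq_mul, TensorProduct.tmul_smul]
  rw [e]
  exact h

/-- Orders `S ≤ O` with `pO ⊆ S` are determined by their completions. The proof compares
coordinates in a `ℤ`-basis of `O`: an element of `O` that lies in `p O_p` lies in `pO`. -/
theorem le_of_completedOrder_le [NumberField K] {S O : Subalgebra ℤ K} (hO : IsOrder ℤ ℚ O)
    (hSO : S ≤ O) (hpS : ∀ x ∈ O, (p : K) * x ∈ S)
    (h : completedOrder p O ≤ completedOrder p S) : O ≤ S := by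
  obtain ⟨b, c, hbc⟩ := hO.exists_basis
  let B := c.baseChange ℚ_[p]
  have hrepr : ∀ z : O, ∀ i,
      B.repr ((1 : ℚ_[p]) ⊗ₜ[ℚ] (z : K)) i = ((b.repr z i : ℤ) : ℚ_[p]) := by
    intro z i
    have e : (1 : ℚ_[p]) ⊗ₜ[ℚ] (z : K) = ∑ j, ((b.repr z j : ℤ) : ℚ_[p]) • B j := by
      have h1 : (z : K) = ∑ j, (b.repr z j) • c j := by
        conv_lhs => rw [← b.sum_repr z]
        simp [hbc]
      rw [h1, TensorProduct.tmul_sum]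
      refine Finset.sum_congr rfl fun j _ => ?_
      rw [Module.Basis.baseChange_apply, TensorProduct.tmul_smul, Int.cast_smul_eq_zsmul]
    rw [e, Module.Basis.repr_sum_self]
  have hint : ∀ y ∈ completedOrder p O, ∀ i, ∃ d : ℤ_[p], B.repr y i = d := by
    intro y hy i
    let N : Submodule ℤ_[p] (ℚ_[p] ⊗[ℚ] K) :=
      { carrier := {y | ∃ d : ℤ_[p], B.repr y i = d}
        add_mem' := by
          rintro x y ⟨d, hd⟩ ⟨e, he⟩
          exact ⟨d + e, by rw [map_add, Finsupp.add_apply, hd, he, PadicInt.coe_add]⟩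
        zero_mem' := ⟨0, by simp⟩
        smul_mem' := by
          rintro r x ⟨d, hd⟩
          refine ⟨r * d, ?_⟩
          rw [← algebraMap_smul ℚ_[p] r x, map_smul, Finsupp.smul_apply, hd, smul_eq_mul,
            PadicInt.coe_mul]
          rfl }
    exact completedOrder_le (N := N) (fun x hx => ⟨(b.repr ⟨x, hx⟩ i : ℤ), by
      rw [hrepr ⟨x, hx⟩, PadicInt.coe_intCast]⟩) hy
  have happrox : ∀ y ∈ completedOrder p S, ∃ s ∈ S, ∃ w ∈ completedOrder p O,
      y = (1 : ℚ_[p]) ⊗ₜ[ℚ] s + (p : ℤ_[p]) • w := by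
    intro y hy
    let N : Submodule ℤ_[p] (ℚ_[p] ⊗[ℚ] K) :=
      { carrier := {y | ∃ s ∈ S, ∃ w ∈ completedOrder p O,
          y = (1 : ℚ_[p]) ⊗ₜ[ℚ] s + (p : ℤ_[p]) • w}
        add_mem' := by
          rintro _ _ ⟨s, hs, w, hw, rfl⟩ ⟨s', hs', w', hw', rfl⟩
          exact ⟨s + s', add_mem hs hs', w + w', add_mem hw hw', by
            rw [TensorProduct.tmul_add, smul_add, add_add_add_comm]⟩
        zero_mem' := ⟨0, zero_mem _, 0, zero_mem _, by simp⟩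
        smul_mem' := by
          rintro r _ ⟨s, hs, w, hw, rfl⟩
          obtain ⟨-, hr⟩ := PadicInt.zmodRepr_spec r
          rw [PadicInt.maximalIdeal_eq_span_p] at hr
          obtain ⟨d, hd⟩ := Ideal.mem_span_singleton'.1 hr
          -- `r = r.zmodRepr + p d` with a natural number `r.zmodRepr`.
          refine ⟨r.zmodRepr • s, nsmul_mem hs _, d • ((1 : ℚ_[p]) ⊗ₜ[ℚ] s) + r • w,
            add_mem ((completedOrder p O).smul_mem (tmul_mem_completedOrder p (hSO hs)) d)
              ((completedOrder p O).smul_mem hw r), ?_⟩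
          have er : r = (r.zmodRepr : ℤ_[p]) + p * d := by rw [mul_comm, hd]; ring
          rw [smul_add, smul_add, smul_smul _ d, smul_comm r, ← add_assoc,
            TensorProduct.tmul_smul, ← Nat.cast_smul_eq_nsmul ℤ_[p], ← add_smul, ← er] }
    exact completedOrder_le (N := N) (fun x hx => ⟨x, hx, 0, zero_mem _, by simp⟩) hy
  intro x hx
  obtain ⟨s, hs, w, hw, e⟩ := happrox _ (h (tmul_mem_completedOrder p hx))
  have hdvd : ∀ i, ∃ d : ℤ, b.repr (⟨x, hx⟩ - ⟨s, hSO hs⟩ : O) i = p * d := by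
    intro i
    obtain ⟨d, hd⟩ := hint w hw i
    have h1 := hrepr (⟨x, hx⟩ - ⟨s, hSO hs⟩ : O) i
    have h2 : (1 : ℚ_[p]) ⊗ₜ[ℚ] (((⟨x, hx⟩ - ⟨s, hSO hs⟩ : O)) : K) =
        algebraMap ℤ_[p] ℚ_[p] (p : ℤ_[p]) • w := by
      rw [algebraMap_smul, ← sub_eq_iff_eq_add'.2 e, ← TensorProduct.tmul_sub]
      rfl
    rw [h2, map_smul, Finsupp.smul_apply, hd, smul_eq_mul] at h1
    have h3 : (p : ℤ_[p]) * d = ((b.repr (⟨x, hx⟩ - ⟨s, hSO hs⟩ : O) i : ℤ) : ℤ_[p]) := by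
      refine Subtype.val_injective ?_
      rw [PadicInt.coe_mul, PadicInt.coe_intCast]
      exact h1
    have h4 : (p : ℤ) ∣ b.repr (⟨x, hx⟩ - ⟨s, hSO hs⟩ : O) i := by
      rw [← PadicInt.norm_int_lt_one_iff_dvd, ← h3, norm_mul]
      exact (mul_le_of_le_one_right (norm_nonneg _) d.norm_le_one).trans_lt (by
        rw [PadicInt.norm_p]
        exact inv_lt_one_of_one_lt₀ (Nat.one_lt_cast.2 (Fact.out : p.Prime).one_lt))
    exact h4
  choose d hd using hdvd
  have hxs : (⟨x, hx⟩ - ⟨s, hSO hs⟩ : O) = (p : O) * ∑ i, d i • b i := by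
    conv_lhs => rw [← b.sum_repr (⟨x, hx⟩ - ⟨s, hSO hs⟩ : O)]
    rw [Finset.mul_sum]
    refine Finset.sum_congr rfl fun i _ => ?_
    rw [hd, mul_smul, natCast_zsmul, nsmul_eq_mul]
  have hxs' : x - s = p * ((∑ i, d i • b i : O) : K) := by
    have := congrArg Subtype.val hxs
    rwa [MulMemClass.coe_mul, AddSubgroupClass.coe_sub, SubringClass.coe_natCast] at this
  rw [sub_eq_iff_eq_add.1 hxs']
  exact add_mem (hpS _ (Subtype.mem _)) hs

end Completion

/-- The suborders of `O` are submodules of a Noetherian module. -/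
theorem IsOrder.exists_isMaximalSuborder {R F A : Type*} [CommRing R] [IsNoetherianRing R]
    [Field F] [CommRing A] [Algebra R A] [Algebra F A] {S O : Subalgebra R A}
    (hO : IsOrder R F O) (hS : IsOrder R F S) (hlt : S < O) :
    ∃ L, IsMaximalSuborder R F L O ∧ S ≤ L := by
  have : Module.Finite R O := Module.Finite.iff_fg.2 hO.fg
  have : IsNoetherian R O := inferInstance
  let f : Subalgebra R A → Submodule R O := fun T =>
    (Subalgebra.toSubmodule T).comap O.val.toLinearMap
  let s : Set (Submodule R O) := f '' {T | (IsOrder R F T ∧ T < O) ∧ S ≤ T}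
  obtain ⟨_, ⟨L, ⟨hL, hSL⟩, rfl⟩, hmax⟩ := (wellFounded_gt (α := Submodule R O)).has_min s
    ⟨_, S, ⟨⟨hS, hlt⟩, le_rfl⟩, rfl⟩
  refine ⟨L, ⟨hL, fun T hT hLT => ?_⟩, hSL⟩
  have h1 : f L ≤ f T := fun x hx => hLT hx
  have h2 : f T ≤ f L := by
    by_contra hn
    exact hmax _ ⟨T, ⟨hT, hSL.trans hLT⟩, rfl⟩ (lt_of_le_not_ge h1 hn)
  intro x hx
  exact h2 (show (⟨x, hT.2.le hx⟩ : O) ∈ f T from hx)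

/-! ### Lattices whose powers never fill the order -/

section Powers

variable {K : Type*} [Field K] [CharZero K]

theorem pow_ne_toSubmodule_of_unit_mul_mem {p : ℕ} [Fact p.Prime] {O : Subalgebra ℤ K}
    {H : Submodule ℤ K} (u : (completedOrder p O)ˣ) {L : Subalgebra ℤ_[p] (ℚ_[p] ⊗[ℚ] K)}
    (hL : L < completedOrder p O)
    (h : ∀ x ∈ completion p H, ((u : completedOrder p O) : ℚ_[p] ⊗[ℚ] K) * x ∈ L) (r : ℕ) :
    H ^ r ≠ Subalgebra.toSubmodule O := by
  intro hr
  have hpow : ∀ k, ∀ x ∈ H ^ k,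
      ((u : completedOrder p O) : ℚ_[p] ⊗[ℚ] K) ^ k * (1 ⊗ₜ[ℚ] x) ∈ L := by
    intro k
    induction k with
    | zero =>
      intro x hx
      rw [pow_zero] at hx
      obtain ⟨n, rfl⟩ := Submodule.mem_one.1 hx
      rw [pow_zero, one_mul, eq_intCast, ← zsmul_one, TensorProduct.tmul_smul,
        ← Algebra.TensorProduct.one_def]
      exact zsmul_mem (one_mem L) n
    | succ k ih =>
      intro x hx
      rw [pow_succ] at hx
      refine Submodule.mul_induction_on hx (fun a ha b hb => ?_) (fun a b ha hb => ?_)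
      · have := L.mul_mem (ih a ha) (h _ (tmul_mem_completion p hb))
        rwa [mul_mul_mul_comm, ← pow_succ, Algebra.TensorProduct.tmul_mul_tmul, one_mul] at this
      · rw [TensorProduct.tmul_add, mul_add]
        exact add_mem ha hb
  have hle : Subalgebra.toSubmodule (completedOrder p O) ≤ (Subalgebra.toSubmodule L).comap
      (LinearMap.mulLeft ℤ_[p] (((u : completedOrder p O) : ℚ_[p] ⊗[ℚ] K) ^ r)) :=
    completedOrder_le fun x hx => hpow r x (by rw [hr]; exact hx)
  refine hL.not_ge fun y hy => ?_
  have hmem := hle (((↑u⁻¹ : completedOrder p O) ^ r * ⟨y, hy⟩ : completedOrder p O)).2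
  rw [Submodule.mem_comap, LinearMap.mulLeft_apply] at hmem
  have e : ((u : completedOrder p O) : ℚ_[p] ⊗[ℚ] K) ^ r *
      (((↑u⁻¹ : completedOrder p O) ^ r * ⟨y, hy⟩ : completedOrder p O) : ℚ_[p] ⊗[ℚ] K) = y := by
    have : (u : completedOrder p O) ^ r * ((↑u⁻¹ : completedOrder p O) ^ r * ⟨y, hy⟩) =
        ⟨y, hy⟩ := by
      rw [← mul_assoc, ← mul_pow, Units.mul_inv, one_pow, one_mul]
    exact congrArg Subtype.val this
  rwa [e] at hmem

/-- For a suitable `m ≥ 1`, the lattice `H ^ m + pO` is a ring. -/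
theorem IsOrder.exists_suborder_of_mul_eq {p : ℕ} (hp : p ≠ 0) {O : Subalgebra ℤ K}
    (hO : IsOrder ℤ ℚ O) {H : Submodule ℤ K} (hH : H ≤ Subalgebra.toSubmodule O)
    (hOH : Subalgebra.toSubmodule O * H = Subalgebra.toSubmodule O) :
    ∃ m, 1 ≤ m ∧ ∃ S : Subalgebra ℤ K, ∀ x, x ∈ S ↔ ∃ h ∈ H ^ m, ∃ t ∈ O, x = h + p * t := by
  have := hO.finite_quotient hp
  let π : O →ₐ[ℤ] O ⧸ Ideal.span {(p : O)} := Ideal.Quotient.mkₐ ℤ _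
  let W : Submodule ℤ O := H.comap O.val.toLinearMap
  have hmap : W.map O.val.toLinearMap = H :=
    Submodule.map_comap_eq_of_le fun x hx => ⟨⟨x, hH hx⟩, rfl⟩
  have hspan : Ideal.span (W.map π.toLinearMap : Set (O ⧸ Ideal.span {(p : O)})) = ⊤ := by
    have hle : Subalgebra.toSubmodule O * H ≤ idealLattice (Ideal.span (W : Set O)) :=
      Submodule.mul_le.2 fun x hx y hy =>
        ⟨⟨x, hx⟩ * ⟨y, hH hy⟩, Ideal.mul_mem_left _ _ (Ideal.subset_span hy), rfl⟩
    obtain ⟨w, hw, e⟩ := mem_idealLattice.1 (hle (hOH.ge O.one_mem))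
    have hw1 : w = 1 := Subtype.val_injective e
    have := Ideal.mem_map_of_mem π (hw1 ▸ hw)
    rw [map_one, Ideal.map_span] at this
    exact (Ideal.eq_top_iff_one _).2 this
  obtain ⟨m, hm, h1, hmul⟩ := exists_one_mem_pow hspan
  let T : Subalgebra ℤ (O ⧸ Ideal.span {(p : O)}) := ((W.map π.toLinearMap) ^ m).toSubalgebra h1
    fun x y hx hy => hmul ▸ Submodule.mul_mem_mul hx hy
  refine ⟨m, hm, (T.comap π).map O.val, fun x => ?_⟩
  have hWm : (W ^ m).map O.val.toLinearMap = H ^ m := by rw [Submodule.map_pow, hmap]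
  constructor
  · rintro ⟨y, hy, rfl⟩
    have hy' : π y ∈ (W.map π.toLinearMap) ^ m := hy
    rw [← Submodule.map_pow] at hy'
    obtain ⟨w, hw, e⟩ := hy'
    have hyw : y - w ∈ Ideal.span {(p : O)} := Ideal.Quotient.eq.1 e.symm
    obtain ⟨t, ht⟩ := Ideal.mem_span_singleton'.1 hyw
    refine ⟨w, hWm ▸ Submodule.mem_map_of_mem (f := O.val.toLinearMap) hw, t, t.2, ?_⟩
    have := congrArg Subtype.val (sub_eq_iff_eq_add.1 ht.symm)
    change (y : K) = _
    rw [this]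
    push_cast
    ring
  · rintro ⟨h, hh, t, ht, rfl⟩
    rw [← hWm] at hh
    obtain ⟨w, hw, rfl⟩ := hh
    refine ⟨w + (p : O) * ⟨t, ht⟩, ?_, ?_⟩
    · change π _ ∈ (W.map π.toLinearMap) ^ m
      have h0 : π ((p : O) * ⟨t, ht⟩) = 0 := Ideal.Quotient.eq_zero_iff_mem.2
        (Ideal.mul_mem_right _ _ (Ideal.mem_span_singleton_self _))
      rw [map_add, h0, add_zero, ← Submodule.map_pow]
      exact Submodule.mem_map_of_mem (f := π.toLinearMap) hw
    · rfl

/-- For the order `S = H ^ m + pO`, the `S`-module `H S` is principal near `p`; its inverse there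
is `H ^ (m - 1) S`, since `H ^ m S` contains an element of `1 + pO` and hence lies in no maximal
ideal of `S` over `p`. -/
theorem IsOrder.exists_mul_eq_one_add_of_suborder {p : ℕ} (hp : p ≠ 0) {O S : Subalgebra ℤ K}
    (hS : IsOrder ℤ ℚ S) {H : Submodule ℤ K} {m : ℕ} (hm : m ≠ 0)
    (hmem : ∀ x, x ∈ S ↔ ∃ h ∈ H ^ m, ∃ t ∈ O, x = h + p * t) :
    ∃ v ∈ H * Subalgebra.toSubmodule S, ∃ w ∈ H ^ (m - 1) * Subalgebra.toSubmodule S,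
      ∃ t ∈ S, v * w = 1 + p * t := by
  have hHS : H ^ m ≤ Subalgebra.toSubmodule S := fun h hh =>
    (hmem h).2 ⟨h, hh, 0, zero_mem _, by simp⟩
  have hpS : ∀ t ∈ O, (p : K) * t ∈ S := fun t ht => (hmem _).2 ⟨0, zero_mem _, t, ht, by simp⟩
  have hideal : ∀ M : Submodule ℤ K, Subalgebra.toSubmodule S * (M * Subalgebra.toSubmodule S) ≤
      M * Subalgebra.toSubmodule S := fun M => by
    rw [mul_left_comm, toSubmodule_mul_self]
  have hMN : H * Subalgebra.toSubmodule S * (H ^ (m - 1) * Subalgebra.toSubmodule S) =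
      H ^ m * Subalgebra.toSubmodule S := by
    rw [mul_mul_mul_comm, toSubmodule_mul_self, ← pow_succ', Nat.sub_add_cancel
      (Nat.one_le_iff_ne_zero.2 hm)]
  refine hS.exists_mul_eq_one_add hp (hideal H) (hideal _) ?_ fun P hP hpP => ?_
  · rw [hMN]
    exact (mul_le_mul_left hHS _).trans (toSubmodule_mul_self S).le
  obtain ⟨h, hh, t, ht, e⟩ := (hmem 1).1 S.one_mem
  refine ⟨⟨h, hHS hh⟩, ?_, fun hhP => ?_⟩
  · rw [hMN]
    simpa using Submodule.mul_mem_mul hh (show (1 : K) ∈ Subalgebra.toSubmodule S from S.one_mem)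
  have hpt : (⟨p * t, hpS t ht⟩ : S) ∈ P := by
    -- `pO` need not be contained in `pS`, but the square of each of its elements is in `pS`.
    refine hP.isPrime.mem_of_pow_mem 2 ?_
    have e2 : (⟨p * t, hpS t ht⟩ : S) ^ 2 = (p : S) * ⟨p * (t * t), hpS _ (O.mul_mem ht ht)⟩ := by
      refine Subtype.val_injective ?_
      change ((p : K) * t) ^ 2 = ((p : S) : K) * (p * (t * t))
      push_cast
      ring
    rw [e2]
    exact P.mul_mem_right _ hpP
  refine hP.ne_top ((Ideal.eq_top_iff_one _).2 ?_)
  have e1 : (1 : S) = ⟨h, hHS hh⟩ + ⟨p * t, hpS t ht⟩ := Subtype.val_injective e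
  rw [e1]
  exact add_mem hhP hpt

theorem exists_unit_mul_mem_maximalSuborder [NumberField K] {p : ℕ} [Fact p.Prime]
    {O : Subalgebra ℤ K} (hO : IsOrder ℤ ℚ O) {H : Submodule ℤ K} (hH : HasPPowerIndex p O H)
    (hOH : Subalgebra.toSubmodule O * H = Subalgebra.toSubmodule O)
    (hne : ∀ r, 1 ≤ r → H ^ r ≠ Subalgebra.toSubmodule O) :
    ∃ (u : (completedOrder p O)ˣ) (L : Subalgebra ℤ_[p] (ℚ_[p] ⊗[ℚ] K)),
      IsMaximalSuborder ℤ_[p] ℚ_[p] L (completedOrder p O) ∧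
      ∀ h ∈ completion p H, ((u : completedOrder p O) : ℚ_[p] ⊗[ℚ] K) * h ∈ L := by
  have hp : p ≠ 0 := (Fact.out : p.Prime).ne_zero
  have hp' : (p : K) ≠ 0 := Nat.cast_ne_zero.2 hp
  obtain ⟨m, hm, S, hmem⟩ := hO.exists_suborder_of_mul_eq hp hH.1 hOH
  have hm0 : m ≠ 0 := Nat.one_le_iff_ne_zero.1 hm
  have hpS : ∀ t ∈ O, (p : K) * t ∈ S := fun t ht => (hmem _).2 ⟨0, zero_mem _, t, ht, by simp⟩
  have hHO : ∀ k, H ^ k ≤ Subalgebra.toSubmodule O := fun k => by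
    rcases eq_or_ne k 0 with rfl | hk
    · rw [pow_zero]; exact Submodule.one_le.2 O.one_mem
    · exact (pow_le_pow_left' hH.1 k).trans (toSubmodule_pow O hk).le
  have hSO : S ≤ O := by
    intro x hx
    obtain ⟨h, hh, t, ht, rfl⟩ := (hmem x).1 hx
    exact add_mem (hHO m hh) (O.mul_mem (natCast_mem O p) ht)
  have hS : IsOrder ℤ ℚ S := by
    refine isFullLattice_of_mul_mem hO ?_ hp' hpS
    exact Submodule.FG.of_le hO.fg hSO
  have hlt : completedOrder p S < completedOrder p O := by
    refine lt_of_le_not_ge (completedOrder_mono p hSO) fun hge => hne m hm (le_antisymm (hHO m) ?_)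
    have hOS := le_of_completedOrder_le p hO hSO hpS hge
    obtain ⟨k, hk⟩ := hH.exists_pow_mul_mem
    exact mem_of_forall_exists_add_mul (fun x hx => (hmem x).1 (hOS hx)) (pow_mul_mem_pow hk hm0)
  obtain ⟨L, hL, hSL⟩ := (hO.completedOrder p).exists_isMaximalSuborder (hS.completedOrder p) hlt
  obtain ⟨v, hv, w, hw, t, ht, hvw⟩ := hS.exists_mul_eq_one_add_of_suborder hp hm0 hmem
  obtain ⟨η, hη, hη1⟩ := exists_one_add_mul_tmul_mul_eq_one p hS ht
  have hmulO : ∀ k, H ^ k * Subalgebra.toSubmodule S ≤ Subalgebra.toSubmodule O := fun k =>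
    (mul_le_mul' (hHO k) hSO).trans (toSubmodule_mul_self O).le
  have hvO : v ∈ O := by simpa using hmulO 1 (by simpa using hv)
  let vO : completedOrder p O := ⟨_, tmul_mem_completedOrder p hvO⟩
  let wO : completedOrder p O := ⟨_, (completedOrder p O).mul_mem
    (tmul_mem_completedOrder p (hmulO _ hw)) (completedOrder_mono p hSO hη)⟩
  have hwv : wO * vO = 1 := by
    refine Subtype.val_injective ?_
    change (1 : ℚ_[p]) ⊗ₜ[ℚ] w * η * (1 : ℚ_[p]) ⊗ₜ[ℚ] v = 1
    rw [mul_right_comm, Algebra.TensorProduct.tmul_mul_tmul, one_mul, mul_comm w, hvw, hη1]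
  -- The unit is `u = w / (v w)`, with inverse `v`.
  refine ⟨⟨wO, vO, hwv, by rw [mul_comm, hwv]⟩, L, hL, ?_⟩
  have hle : completion p H ≤ (Subalgebra.toSubmodule L).comap
      (LinearMap.mulLeft ℤ_[p] (wO : ℚ_[p] ⊗[ℚ] K)) := by
    refine completion_le fun x hx => hSL ?_
    change (1 : ℚ_[p]) ⊗ₜ[ℚ] w * η * (1 : ℚ_[p]) ⊗ₜ[ℚ] x ∈ completedOrder p S
    rw [mul_right_comm, Algebra.TensorProduct.tmul_mul_tmul, one_mul]
    refine (completedOrder p S).mul_mem (tmul_mem_completedOrder p ?_) hη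
    have hwx := Submodule.mul_mem_mul hw hx
    rw [mul_right_comm, ← pow_succ, Nat.sub_add_cancel hm] at hwx
    have hHS : H ^ m ≤ Subalgebra.toSubmodule S := fun h hh =>
      (hmem h).2 ⟨h, hh, 0, zero_mem _, by simp⟩
    exact ((mul_le_mul_left hHS _).trans (toSubmodule_mul_self S).le) hwx
  exact fun h hh => hle hh

end Powers

theorem lemma5p5 {K : Type*} [Field K] [NumberField K] (p : ℕ) [Fact p.Prime]
    (O : Subalgebra ℤ K) (hO : IsOrder ℤ ℚ O) :
    (∀ H : Submodule ℤ K, HasPPowerIndex p O H →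
      Subalgebra.toSubmodule O * H = Subalgebra.toSubmodule O →
      ((∀ r : ℕ, 1 ≤ r → H ^ r ≠ Subalgebra.toSubmodule O) ↔
        ∃ (u : (completedOrder p O)ˣ) (L : Subalgebra ℤ_[p] (ℚ_[p] ⊗[ℚ] K)),
          IsMaximalSuborder ℤ_[p] ℚ_[p] L (completedOrder p O) ∧
          ∀ h ∈ completion p H, ((u : completedOrder p O) : ℚ_[p] ⊗[ℚ] K) * h ∈ L)) ∧
    (∀ (I a I' : Submodule ℤ K) (b : Ideal O),
      HasPPowerIndex p O I → (p : K) ∈ I →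
      a = I * Subalgebra.toSubmodule O →
      a ≤ idealLattice (pRadical p O) → IsInvertibleIdeal O a →
      b ≤ pRadical p O ^ 2 ⊔ Ideal.span {(p : O)} →
      a ^ 2 * idealLattice b ≤ I →
      I' = I ⊔ a * idealLattice b →
      (SatisfiesCond p O I ↔ SatisfiesCond p O I' ∧ I' ^ 2 ≤ I)) := by
  refine ⟨fun H hH hOH => ⟨exists_unit_mul_mem_maximalSuborder hO hH hOH, ?_⟩,
    fun I a I' b hI hpI ha haJ hinv hb hab hI' =>
      satisfiesCond_iff hO hI hpI ha haJ hinv hb hab hI'⟩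
  rintro ⟨u, L, hL, h⟩ r -
  exact pow_ne_toSubmodule_of_unit_mul_mem u hL.prop.2 h r
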